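/- Let $0<\alpha<1$, $\alpha_0>0$, $\varepsilon>0$, $\beta\in\mathbb R$, and let $\mathbb T=\mathbb R/2\pi\mathbb Z$. Let $$\mathcal H[f](x)=\frac1{2\pi}\,\mathrm{p.v.}\!\int_{-\pi}^{\pi}\frac{f(y)}{\tan\left(\frac{x-y}{2}\right)}\,dy$$ be the periodic Hilbert transform and $[\![\mathcal H,f]\!][g]=\mathcal H(fg)-f\,\mathcal H(g)$. Let $X$ be the space of functions $f\in C^{3,\alpha}(\mathbb T)$ of the form $f(\xi)=\sum_{k\ge1}f_k\cos(k\xi)$ with the $C^{3,\alpha}$ norm, and $Y$ the space of functions $f\in C^{1,\alpha}(\mathbb T)$ of the form $f(\xi)=\sum_{k\ge1}f_k\sin(k\xi)$ with the $C^{1,\alpha}$ norm. For $c\in\mathbb R$ and $\varphi\in X$ put $$F[c,\varphi]=2c\varphi'+\Big(c\alpha_0+\frac{\alpha_0-\beta}{\varepsilon}\Big)\mathcal H[\varphi'']+\frac1\varepsilon\big\{\varphi'+\mathcal H[\varphi]\big\}+\mathcal H[(\mathcal H\varphi')^2]-[\![\mathcal H,\varphi]\!][\mathcal H\varphi']-(\alpha_0-\beta)[\![\mathcal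 H,\varphi]\!][\mathcal H\varphi'''].$$ Let $c\in\mathbb R$ be such that $c\alpha_0+\frac{\alpha_0-\beta}{\varepsilon}\ne0$. Then $F[c,\cdot]$ maps $X$ into $Y$ and is Fréchet differentiable at $\varphi=0$; its derivative there is the bounded operator $X\to Y$ given by $$\partial_\varphi F[c,0]h=2ch'+\Big(c\alpha_0+\frac{\alpha_0-\beta}{\varepsilon}\Big)\mathcal H[h'']+\frac1\varepsilon\big\{h'+\mathcal H[h]\big\},$$ and $\partial_\varphi F[c,0]:X\to Y$ is a Fredholm operator of index zero. -/

import Mathlib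

open Set Filter Topology
open scoped NNReal

noncomputable section

/-- `C^{k,α}(𝕋)`, `𝕋 = ℝ / 2πℤ`, as a space of `2π`-periodic functions on the line: `f` is `k` times
continuously differentiable and `f^{(k)}` is Hölder continuous of exponent `α`. -/
def holderSubmodule (k : ℕ) (α : ℝ≥0) : Submodule ℝ (ℝ → ℝ) where
  carrier := {f | Function.Periodic f (2 * Real.pi) ∧ ContDiff ℝ k f ∧
    MemHolder α (iteratedDeriv k f)}
  add_mem' := by
    rintro f g ⟨hf, hf', hf''⟩ ⟨hg, hg', hg''⟩
    refine ⟨hf.add hg, hf'.add hg', ?_⟩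
    have h : iteratedDeriv k (f + g) = iteratedDeriv k f + iteratedDeriv k g :=
      funext fun x => iteratedDeriv_add hf'.contDiffAt hg'.contDiffAt
    rw [h]
    exact hf''.add hg''
  zero_mem' := by
    refine ⟨fun x => rfl, contDiff_const, ?_⟩
    have h : iteratedDeriv k (0 : ℝ → ℝ) = 0 := funext fun x => iteratedDeriv_const_zero
    rw [h]
    exact memHolder_zero
  smul_mem' := by
    rintro c f ⟨hf, hf', hf''⟩
    refine ⟨hf.smul c, hf'.const_smul c, ?_⟩
    have h : iteratedDeriv k (c • f) = c • iteratedDeriv k f :=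
      funext fun x => iteratedDeriv_const_smul hf'.contDiffAt c
    rw [h]
    exact hf''.smul

/-- The type `C^{k,α}(𝕋; ℝ)`; it carries the Hölder norm below (not the topology of pointwise
convergence of `ℝ → ℝ`). -/
def HolderTorus (k : ℕ) (α : ℝ≥0) : Type := holderSubmodule k α

namespace HolderTorus

variable {k : ℕ} {α : ℝ≥0}

instance : AddCommGroup (HolderTorus k α) :=
  inferInstanceAs (AddCommGroup (holderSubmodule k α))

instance : Module ℝ (HolderTorus k α) :=
  inferInstanceAs (Module ℝ (holderSubmodule k α))

/-- The underlying function. -/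
def toFun (f : HolderTorus k α) : ℝ → ℝ := Subtype.val f

instance : CoeFun (HolderTorus k α) (fun _ => ℝ → ℝ) := ⟨toFun⟩

theorem toFun_injective : Function.Injective (toFun : HolderTorus k α → ℝ → ℝ) :=
  Subtype.val_injective

@[simp] theorem toFun_zero : toFun (0 : HolderTorus k α) = 0 := rfl

@[simp] theorem toFun_add (f g : HolderTorus k α) : toFun (f + g) = toFun f + toFun g := rfl

@[simp] theorem toFun_smul (c : ℝ) (f : HolderTorus k α) : toFun (c • f) = c • toFun f := rfl

theorem periodic (f : HolderTorus k α) : Function.Periodic f (2 * Real.pi) := f.2.1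

theorem contDiff (f : HolderTorus k α) : ContDiff ℝ k f := f.2.2.1

theorem memHolder (f : HolderTorus k α) : MemHolder α (iteratedDeriv k f) := f.2.2.2

theorem iteratedDeriv_toFun_add (f g : HolderTorus k α) {l : ℕ} (hl : l ≤ k) :
    iteratedDeriv l (toFun (f + g)) = iteratedDeriv l f + iteratedDeriv l g :=
  funext fun _ => iteratedDeriv_add (f.contDiff.of_le (by exact_mod_cast hl)).contDiffAt
    (g.contDiff.of_le (by exact_mod_cast hl)).contDiffAt

theorem iteratedDeriv_toFun_smul (c : ℝ) (f : HolderTorus k α) {l : ℕ} (hl : l ≤ k) :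
    iteratedDeriv l (toFun (c • f)) = c • iteratedDeriv l f :=
  funext fun _ => iteratedDeriv_const_smul (f.contDiff.of_le (by exact_mod_cast hl)).contDiffAt c

theorem bddAbove_iteratedDeriv (f : HolderTorus k α) {l : ℕ} (hl : l ≤ k) :
    BddAbove (range fun x => |iteratedDeriv l f x|) := by
  have hc : Continuous (iteratedDeriv l f) :=
    f.contDiff.continuous_iteratedDeriv l (by exact_mod_cast hl)
  have hp : Function.Periodic (fun x => |iteratedDeriv l f x|) (2 * Real.pi) := by
    intro x
    have h : (fun z => toFun f (z + 2 * Real.pi)) = toFun f := funext f.periodic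
    have h' := congrFun (iteratedDeriv_comp_add_const l (toFun f) (2 * Real.pi)) x
    rw [h] at h'
    simp only [h']
  have := hp.compact_of_continuous (by positivity) hc.abs
  exact this.bddAbove

/-- The Hölder norm `∑_{l ≤ k} sup |f^{(l)}| + [f^{(k)}]_α`. For a periodic function the
supremum of the Hölder quotients over `ℝ` is the one over the circle. -/
instance : Norm (HolderTorus k α) where
  norm f := ∑ l ∈ Finset.range (k + 1), (⨆ x, |iteratedDeriv l f x|)
    + (nnHolderNorm α (iteratedDeriv k f) : ℝ)

theorem norm_def (f : HolderTorus k α) :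
    ‖f‖ = ∑ l ∈ Finset.range (k + 1), (⨆ x, |iteratedDeriv l f x|)
      + (nnHolderNorm α (iteratedDeriv k f) : ℝ) := rfl

theorem normCore : NormedSpace.Core ℝ (HolderTorus k α) where
  norm_nonneg f := add_nonneg
    (Finset.sum_nonneg fun l _ => Real.iSup_nonneg fun x => abs_nonneg _) (NNReal.coe_nonneg _)
  norm_smul c f := by
    rw [norm_def, norm_def, mul_add, Finset.mul_sum]
    congr 1
    · refine Finset.sum_congr rfl fun l hl => ?_
      rw [iteratedDeriv_toFun_smul c f (by simpa [Nat.lt_succ_iff] using hl),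
        Real.mul_iSup_of_nonneg (norm_nonneg c)]
      simp [abs_mul]
    · rw [iteratedDeriv_toFun_smul c f le_rfl, f.memHolder.nnHolderNorm_smul]
      simp
  norm_triangle f g := by
    have h1 : ∑ l ∈ Finset.range (k + 1), (⨆ x, |iteratedDeriv l (toFun (f + g)) x|) ≤
        ∑ l ∈ Finset.range (k + 1), (⨆ x, |iteratedDeriv l f x|) +
        ∑ l ∈ Finset.range (k + 1), (⨆ x, |iteratedDeriv l g x|) := by
      rw [← Finset.sum_add_distrib]
      refine Finset.sum_le_sum fun l hl => ?_
      have hl : l ≤ k := by simpa [Nat.lt_succ_iff] using hl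
      rw [iteratedDeriv_toFun_add f g hl]
      refine ciSup_le fun x => (abs_add_le _ _).trans (add_le_add ?_ ?_)
      · exact le_ciSup (f.bddAbove_iteratedDeriv hl) x
      · exact le_ciSup (g.bddAbove_iteratedDeriv hl) x
    have h2 : (nnHolderNorm α (iteratedDeriv k (toFun (f + g))) : ℝ) ≤
        nnHolderNorm α (iteratedDeriv k f) + nnHolderNorm α (iteratedDeriv k g) := by
      rw [iteratedDeriv_toFun_add f g le_rfl]
      exact_mod_cast f.memHolder.nnHolderNorm_add_le g.memHolder
    rw [norm_def, norm_def, norm_def]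
    linarith
  norm_eq_zero_iff f := by
    constructor
    · intro h
      have hs : ∀ l ∈ Finset.range (k + 1), 0 ≤ ⨆ x, |iteratedDeriv l f x| :=
        fun l _ => Real.iSup_nonneg fun x => abs_nonneg _
      rw [norm_def] at h
      have h0 := Finset.single_le_sum hs (Finset.mem_range.2 (Nat.succ_pos k))
      have h1 : 0 ≤ (nnHolderNorm α (iteratedDeriv k f) : ℝ) := NNReal.coe_nonneg _
      apply toFun_injective
      funext x
      have h2 := le_ciSup (f.bddAbove_iteratedDeriv (Nat.zero_le k)) x
      simp only [iteratedDeriv_zero] at h0 h2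
      have h3 : |toFun f x| ≤ 0 := by linarith
      simpa using h3
    · rintro rfl
      have h : ∀ l, iteratedDeriv l (0 : ℝ → ℝ) = 0 :=
        fun l => funext fun x => iteratedDeriv_const_zero
      simp [norm_def, h]

instance : NormedAddCommGroup (HolderTorus k α) := NormedAddCommGroup.ofCore normCore

instance : NormedSpace ℝ (HolderTorus k α) := NormedSpace.ofCore normCore

end HolderTorus

/-- `X`: the functions `∑_{k ≥ 1} f_k cos (k ξ)` in `C^{3,α}(𝕋)`, with the `C^{3,α}` norm.
The coefficient of `cos ((k + 1) ξ)` is `a k`; Fourier series of functions of this regularity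
converge absolutely. -/
def spaceX (α : ℝ≥0) : Submodule ℝ (HolderTorus 3 α) where
  carrier := {f | ∃ a : ℕ → ℝ, Summable a ∧
    ∀ ξ : ℝ, HasSum (fun k : ℕ => a k * Real.cos ((k + 1) * ξ)) (f ξ)}
  add_mem' := by
    rintro f g ⟨a, ha, hf⟩ ⟨b, hb, hg⟩
    exact ⟨a + b, ha.add hb, fun ξ => by simpa [add_mul] using (hf ξ).add (hg ξ)⟩
  zero_mem' := ⟨0, summable_zero, fun ξ => by simp⟩
  smul_mem' := by
    rintro c f ⟨a, ha, hf⟩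
    exact ⟨c • a, ha.const_smul c, fun ξ => by simpa [mul_assoc] using (hf ξ).mul_left c⟩

/-- `Y`: the functions `∑_{k ≥ 1} f_k sin (k ξ)` in `C^{1,α}(𝕋)`, with the `C^{1,α}` norm. -/
def spaceY (α : ℝ≥0) : Submodule ℝ (HolderTorus 1 α) where
  carrier := {f | ∃ a : ℕ → ℝ, Summable a ∧
    ∀ ξ : ℝ, HasSum (fun k : ℕ => a k * Real.sin ((k + 1) * ξ)) (f ξ)}
  add_mem' := by
    rintro f g ⟨a, ha, hf⟩ ⟨b, hb, hg⟩
    exact ⟨a + b, ha.add hb, fun ξ => by simpa [add_mul] using (hf ξ).add (hg ξ)⟩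
  zero_mem' := ⟨0, summable_zero, fun ξ => by simp⟩
  smul_mem' := by
    rintro c f ⟨a, ha, hf⟩
    exact ⟨c • a, ha.const_smul c, fun ξ => by simpa [mul_assoc] using (hf ξ).mul_left c⟩

/-- The periodic Hilbert transform
`H[f](x) = (1 / 2π) p.v. ∫ f(y) / tan ((x - y) / 2) dy` of a `2π`-periodic function; the integrand
is `2π`-periodic in `y`, and the period is taken symmetric about the singularity `y = x`. The
limit exists whenever `f` is Hölder continuous. -/
def hilbert (f : ℝ → ℝ) (x : ℝ) : ℝ :=
  limUnder (𝓝[>] (0 : ℝ)) fun δ : ℝ =>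
    (1 / (2 * Real.pi)) *
      ((∫ y in (x - Real.pi)..(x - δ), f y / Real.tan ((x - y) / 2)) +
        ∫ y in (x + δ)..(x + Real.pi), f y / Real.tan ((x - y) / 2))

/-- The commutator `⟦H, f⟧[g] = H[f g] - f H[g]`. -/
def hilbertCommutator (f g : ℝ → ℝ) (x : ℝ) : ℝ :=
  hilbert (fun y => f y * g y) x - f x * hilbert g x

/-- The nonlinear travelling-wave operator `F[c, φ]`, with parameters `α₀`, `β`, `ε`. -/
def waveF (α₀ β ε c : ℝ) (φ : ℝ → ℝ) (ξ : ℝ) : ℝ :=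
  2 * c * deriv φ ξ
    + (c * α₀ + (α₀ - β) / ε) * hilbert (iteratedDeriv 2 φ) ξ
    + (1 / ε) * (deriv φ ξ + hilbert φ ξ)
    + hilbert (fun y => (hilbert (deriv φ) y) ^ 2) ξ
    - hilbertCommutator φ (hilbert (deriv φ)) ξ
    - (α₀ - β) * hilbertCommutator φ (hilbert (iteratedDeriv 3 φ)) ξ

end

/-! The operator splits as `linPart` plus `quadPart`, linear and quadratic in φ. If the quadratic
part maps X to Y with norm at most C‖φ‖², it has derivative zero at 0, and everything else concerns
the linear part.

Both parts rest on Privalov's theorem (`exists_holderBound_hilbert`). In the quadratic part, the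
only term that seems to lose regularity is ⟦H, φ⟧[Hφ'''], since Hφ''' is merely C^{0,α}. But Hφ''' =
G' with G = Hφ'' in C^{1,α}, and the commutator has kernel (φ(y) - φ(x)) cot((x - y)/2). Integrating
by parts moves the derivative from G to this kernel, and the result stays bounded because φ'' is.
One derivative in x can then be taken, falling on φ or on G (`HolderBound.hilbertCommutator`).

The linear part is diagonal: writing P = 2c, R = 1/ε and Q for the nonzero coefficient of H[h''], it
sends cos kξ to -(Qk² + (P + R)k - R) sin kξ. As Q ≠ 0, this symbol vanishes at finitely many k
only. What needs work is that its inverse off the zeros is bounded from C^{1,α} to C^{3,α}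
(`exists_parametrix`). Expand k²/(Qk² + (P + R)k - R) as 1/Q + c₁/k + c₂/k² + O(k⁻³). The multiplier
1/k on sine series is a primitive composed with the Hilbert transform, hence bounded on Hölder
spaces. The remainder acts on coefficients of size O(1/k) and yields coefficients O(k⁻⁴), whose
series may be differentiated twice. The factor k⁻² still missing is again a Hilbert transform and
two integrations.

With this quasi-inverse the operator is Fredholm. Its kernel and its cokernel are both identified
with ℝ^Z, where Z is the zero set of the symbol, so the index is zero (`isFredholm_of_diagonal`). -/

/-! ### Calculus of Hölder bounds. -/

/-- Quantitative membership in `C^{n,α}(ℝ/2πℤ)`: `f` is periodic, `n` times differentiable, all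
derivatives of order at most `n` are bounded by `A`, and the last one has Hölder constant `A`. -/
def HolderBound (α : ℝ) : ℕ → ℝ → (ℝ → ℝ) → Prop
  | 0, A, f => Function.Periodic f (2 * Real.pi) ∧ (∀ x, |f x| ≤ A) ∧
      ∀ x y, |f x - f y| ≤ A * |x - y| ^ α
  | n + 1, A, f => Function.Periodic f (2 * Real.pi) ∧ Differentiable ℝ f ∧ (∀ x, |f x| ≤ A) ∧
      HolderBound α n A (deriv f)

theorem periodic_deriv {f : ℝ → ℝ} {T : ℝ} (hf : Function.Periodic f T) :
    Function.Periodic (deriv f) T := by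
  intro x
  have h := deriv_comp_add_const f T x
  rw [← h]
  congr 1
  exact funext hf

namespace HolderBound

variable {α : ℝ} {n : ℕ} {A B : ℝ} {f g : ℝ → ℝ}

theorem periodic (hf : HolderBound α n A f) : Function.Periodic f (2 * Real.pi) := by
  cases n <;> exact hf.1

theorem abs_le (hf : HolderBound α n A f) (x : ℝ) : |f x| ≤ A := by
  cases n
  · exact hf.2.1 x
  · exact hf.2.2.1 x

theorem nonneg (hf : HolderBound α n A f) : 0 ≤ A := (abs_nonneg _).trans (hf.abs_le 0)

theorem differentiable (hf : HolderBound α (n + 1) A f) : Differentiable ℝ f := hf.2.1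

theorem deriv (hf : HolderBound α (n + 1) A f) : HolderBound α n A (deriv f) := hf.2.2.2

theorem abs_sub_le (hf : HolderBound α 0 A f) (x y : ℝ) : |f x - f y| ≤ A * |x - y| ^ α :=
  hf.2.2 x y

theorem continuous (hα : 0 < α) (hf : HolderBound α n A f) : Continuous f := by
  cases n with
  | succ n => exact hf.differentiable.continuous
  | zero =>
    rw [continuous_iff_continuousAt]
    intro x
    rw [ContinuousAt, tendsto_iff_norm_sub_tendsto_zero]
    have h1 : Tendsto (fun y => A * |y - x| ^ α) (𝓝 x) (𝓝 0) := by
      have : Continuous fun y : ℝ => A * |y - x| ^ α :=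
        continuous_const.mul
          ((continuous_id.sub continuous_const).abs.rpow_const fun _ => Or.inr hα.le)
      have h := this.tendsto x
      simpa [Real.zero_rpow hα.ne'] using h
    exact squeeze_zero (fun _ => norm_nonneg _) (fun y => hf.abs_sub_le y x) h1

theorem mono (hf : HolderBound α n A f) (h : A ≤ B) : HolderBound α n B f := by
  induction n generalizing f with
  | zero =>
    exact ⟨hf.periodic, fun x => (hf.abs_le x).trans h, fun x y =>
      (hf.abs_sub_le x y).trans (mul_le_mul_of_nonneg_right h (by positivity))⟩
  | succ n ih => exact ⟨hf.periodic, hf.differentiable, fun x => (hf.abs_le x).trans h, ih hf.deriv⟩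

theorem add (hf : HolderBound α n A f) (hg : HolderBound α n B g) :
    HolderBound α n (A + B) (fun x => f x + g x) := by
  induction n generalizing f g with
  | zero =>
    refine ⟨hf.periodic.add hg.periodic,
      fun x => (abs_add_le _ _).trans (add_le_add (hf.abs_le x) (hg.abs_le x)), fun x y => ?_⟩
    rw [add_sub_add_comm, add_mul]
    exact (abs_add_le _ _).trans (add_le_add (hf.abs_sub_le x y) (hg.abs_sub_le x y))
  | succ n ih =>
    refine ⟨hf.periodic.add hg.periodic, hf.differentiable.add hg.differentiable,
      fun x => (abs_add_le _ _).trans (add_le_add (hf.abs_le x) (hg.abs_le x)), ?_⟩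
    have : _root_.deriv (fun x => f x + g x) = fun x => _root_.deriv f x + _root_.deriv g x :=
      funext fun x => deriv_fun_add (hf.differentiable x) (hg.differentiable x)
    rw [this]
    exact ih hf.deriv hg.deriv

theorem const_mul (c : ℝ) (hf : HolderBound α n A f) :
    HolderBound α n (|c| * A) (fun x => c * f x) := by
  have hp : Function.Periodic (fun x => c * f x) (2 * Real.pi) := fun x => by
    simp only [hf.periodic x]
  have hb : ∀ x, |c * f x| ≤ |c| * A := fun x => by
    rw [abs_mul]; exact mul_le_mul_of_nonneg_left (hf.abs_le x) (abs_nonneg c)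
  induction n generalizing f with
  | zero =>
    refine ⟨hp, hb, fun x y => ?_⟩
    rw [← mul_sub, abs_mul, mul_assoc]
    exact mul_le_mul_of_nonneg_left (hf.abs_sub_le x y) (abs_nonneg c)
  | succ n ih =>
    refine ⟨hp, hf.differentiable.const_mul c, hb, ?_⟩
    have : _root_.deriv (fun x => c * f x) = fun x => c * _root_.deriv f x :=
      funext fun x => deriv_const_mul c (hf.differentiable x)
    rw [this]
    refine ih hf.deriv (fun x => ?_) fun x => ?_
    · simp only [hf.deriv.periodic x]
    · rw [abs_mul]; exact mul_le_mul_of_nonneg_left (hf.deriv.abs_le x) (abs_nonneg c)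

theorem sub (hf : HolderBound α n A f) (hg : HolderBound α n B g) :
    HolderBound α n (A + B) (fun x => f x - g x) := by
  have h := hf.add (hg.const_mul (-1))
  simpa [sub_eq_add_neg] using h

theorem abs_sub_le_of_deriv (hf : HolderBound α (n + 1) A f) (x y : ℝ) :
    |f x - f y| ≤ A * |x - y| :=
  Convex.norm_image_sub_le_of_norm_deriv_le (s := univ) (fun z _ => hf.differentiable z)
    (fun z _ => hf.deriv.abs_le z) convex_univ (mem_univ y) (mem_univ x)

/-- A bounded Lipschitz periodic function is Hölder continuous. -/
theorem of_lipschitz (hα0 : 0 < α) (hα1 : α < 1) (hp : Function.Periodic f (2 * Real.pi))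
    (hb : ∀ x, |f x| ≤ A) (hl : ∀ x y, |f x - f y| ≤ A * |x - y|) : HolderBound α 0 (2 * A) f := by
  have hA : 0 ≤ A := (abs_nonneg _).trans (hb 0)
  refine ⟨hp, fun x => (hb x).trans (by linarith), fun x y => ?_⟩
  rcases le_total |x - y| 1 with h | h
  · have h1 : |x - y| ≤ |x - y| ^ α := by
      simpa using Real.rpow_le_rpow_of_exponent_ge' (abs_nonneg _) h hα0.le hα1.le
    have h2 : 0 ≤ |x - y| ^ α := by positivity
    calc |f x - f y| ≤ A * |x - y| := hl x y
      _ ≤ A * |x - y| ^ α := mul_le_mul_of_nonneg_left h1 hA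
      _ ≤ 2 * A * |x - y| ^ α := by nlinarith [mul_nonneg hA h2]
  · have h1 : 1 ≤ |x - y| ^ α := Real.one_le_rpow h hα0.le
    calc |f x - f y| ≤ |f x| + |f y| := abs_sub _ _
      _ ≤ 2 * A * 1 := by linarith [hb x, hb y]
      _ ≤ 2 * A * |x - y| ^ α := mul_le_mul_of_nonneg_left h1 (by linarith)

/-- Below top order the last retained derivative is bounded and Lipschitz, which costs a factor 2 in
the Hölder constant. The factor is paid once, whatever the drop in order. -/
theorem of_le (hα0 : 0 < α) (hα1 : α < 1) {m : ℕ} (hm : m ≤ n) (hf : HolderBound α n A f) :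
    HolderBound α m (2 * A) f := by
  induction n generalizing f m with
  | zero =>
    obtain rfl : m = 0 := by lia
    exact hf.mono (by linarith [hf.nonneg])
  | succ n ih =>
    cases m with
    | zero => exact of_lipschitz hα0 hα1 hf.periodic hf.abs_le hf.abs_sub_le_of_deriv
    | succ m =>
      exact ⟨hf.periodic, hf.differentiable, fun x => (hf.abs_le x).trans (by linarith [hf.nonneg]),
        ih (by lia) hf.deriv⟩

theorem of_succ (hα0 : 0 < α) (hα1 : α < 1) (hf : HolderBound α (n + 1) A f) :
    HolderBound α n (2 * A) f :=
  hf.of_le hα0 hα1 n.le_succ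

/-- Each derivative contributes a factor 4: the product rule gives two terms, and in each the
undifferentiated factor is lowered by one order at the price of 2. -/
theorem mul (hα0 : 0 < α) (hα1 : α < 1) (hf : HolderBound α n A f) (hg : HolderBound α n B g) :
    HolderBound α n (2 * 4 ^ n * (A * B)) (fun x => f x * g x) := by
  have hp : Function.Periodic (fun x => f x * g x) (2 * Real.pi) := fun x => by
    simp only [hf.periodic x, hg.periodic x]
  have hA := hf.nonneg
  have hB := hg.nonneg
  have hb : ∀ x, |f x * g x| ≤ A * B := fun x => by
    rw [abs_mul]
    exact mul_le_mul (hf.abs_le x) (hg.abs_le x) (abs_nonneg _) hA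
  have hAB := mul_nonneg hA hB
  have h4 : (1 : ℝ) ≤ 4 ^ n := one_le_pow₀ (by norm_num)
  have hb' : ∀ x, |f x * g x| ≤ 2 * 4 ^ n * (A * B) := fun x => (hb x).trans (by nlinarith)
  clear h4
  induction n generalizing f g A B with
  | zero =>
    refine ⟨hp, hb', fun x y => ?_⟩
    have h1 : f x * g x - f y * g y = (f x - f y) * g x + f y * (g x - g y) := by ring
    rw [h1]
    calc _ ≤ |f x - f y| * |g x| + |f y| * |g x - g y| := by
          simpa [abs_mul] using abs_add_le ((f x - f y) * g x) (f y * (g x - g y))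
      _ ≤ (A * |x - y| ^ α) * B + A * (B * |x - y| ^ α) := by
          gcongr
          · exact hf.abs_sub_le x y
          · exact hg.abs_le x
          · exact hf.abs_le y
          · exact hg.abs_sub_le x y
      _ = _ := by ring
  | succ n ih =>
    refine ⟨hp, hf.differentiable.mul hg.differentiable, hb', ?_⟩
    have : _root_.deriv (fun x => f x * g x) =
        fun x => _root_.deriv f x * g x + f x * _root_.deriv g x :=
      funext fun x => deriv_fun_mul (hf.differentiable x) (hg.differentiable x)
    rw [this]
    -- The induction hypothesis also asks for the periodicity and sup bounds that stood in the
    -- context; these are discharged here.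
    have key : ∀ {f g : ℝ → ℝ} {A B : ℝ}, HolderBound α n A f → HolderBound α n B g →
        HolderBound α n (2 * 4 ^ n * (A * B)) (fun x => f x * g x) := by
      intro f g A B hf hg
      have h4 : (1 : ℝ) ≤ 4 ^ n := one_le_pow₀ (by norm_num)
      have hb : ∀ x, |f x * g x| ≤ A * B := fun x => by
        rw [abs_mul]
        exact mul_le_mul (hf.abs_le x) (hg.abs_le x) (abs_nonneg _) hf.nonneg
      have hAB := mul_nonneg hf.nonneg hg.nonneg
      exact ih hf hg (fun x => by simp only [hf.periodic x, hg.periodic x]) hf.nonneg hg.nonneg hb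
        hAB (fun x => (hb x).trans (by nlinarith))
    refine ((key hf.deriv (hg.of_succ hα0 hα1)).add (key (hf.of_succ hα0 hα1) hg.deriv)).mono
      (le_of_eq ?_)
    ring

theorem contDiff (hα : 0 < α) (hf : HolderBound α n A f) : ContDiff ℝ n f := by
  induction n generalizing f with
  | zero => exact contDiff_zero.2 (hf.continuous hα)
  | succ n ih =>
    have h : ContDiff ℝ ((n : WithTop ℕ∞) + 1) f :=
      contDiff_succ_iff_deriv.2 ⟨hf.differentiable, by simp, ih hf.deriv⟩
    exact_mod_cast h

theorem iteratedDeriv_abs_le (hf : HolderBound α n A f) {l : ℕ} (hl : l ≤ n) (x : ℝ) :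
    |iteratedDeriv l f x| ≤ A := by
  induction n generalizing f l with
  | zero =>
    obtain rfl : l = 0 := by lia
    simpa using hf.abs_le x
  | succ n ih =>
    cases l with
    | zero => simpa using hf.abs_le x
    | succ l =>
      rw [iteratedDeriv_succ']
      exact ih hf.deriv (by lia)

theorem iteratedDeriv_abs_sub_le (hf : HolderBound α n A f) (x y : ℝ) :
    |iteratedDeriv n f x - iteratedDeriv n f y| ≤ A * |x - y| ^ α := by
  induction n generalizing f with
  | zero => simpa using hf.abs_sub_le x y
  | succ n ih =>
    rw [iteratedDeriv_succ']
    exact ih hf.deriv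

theorem of_iteratedDeriv (hp : Function.Periodic f (2 * Real.pi)) (hd : ContDiff ℝ n f)
    (hb : ∀ l ≤ n, ∀ x, |iteratedDeriv l f x| ≤ A)
    (hh : ∀ x y, |iteratedDeriv n f x - iteratedDeriv n f y| ≤ A * |x - y| ^ α) :
    HolderBound α n A f := by
  induction n generalizing f with
  | zero => exact ⟨hp, fun x => by simpa using hb 0 le_rfl x, fun x y => by simpa using hh x y⟩
  | succ n ih =>
    have hd' : ContDiff ℝ ((n : WithTop ℕ∞) + 1) f := by exact_mod_cast hd
    rw [contDiff_succ_iff_deriv] at hd'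
    refine ⟨hp, hd'.1, fun x => by simpa using hb 0 (by lia) x,
      ih (periodic_deriv hp) hd'.2.2 (fun l hl x => ?_) fun x y => ?_⟩
    · rw [← iteratedDeriv_succ']
      exact hb _ (by lia) x
    · rw [← iteratedDeriv_succ']
      exact hh x y

end HolderBound

theorem holderWith_of_abs_sub_le {α : ℝ≥0} {A : ℝ} (hA : 0 ≤ A) {f : ℝ → ℝ}
    (h : ∀ x y, |f x - f y| ≤ A * |x - y| ^ (α : ℝ)) : HolderWith A.toNNReal α f := by
  intro x y
  rw [edist_dist, edist_dist, ENNReal.ofReal_rpow_of_nonneg dist_nonneg α.coe_nonneg]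
  change _ ≤ ENNReal.ofReal A * _
  rw [← ENNReal.ofReal_mul hA]
  exact ENNReal.ofReal_le_ofReal (h x y)

theorem HolderWith.abs_sub_le {α C : ℝ≥0} {f : ℝ → ℝ} (h : HolderWith C α f) (x y : ℝ) :
    |f x - f y| ≤ C * |x - y| ^ (α : ℝ) :=
  h.dist_le x y

/-- A function satisfying a Hölder bound, as an element of the Hölder space. -/
def HolderBound.toHolderTorus {α : ℝ≥0} (hα : 0 < α) {n : ℕ} {A : ℝ} {f : ℝ → ℝ}
    (hf : HolderBound α n A f) : HolderTorus n α :=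
  ⟨f, hf.periodic, hf.contDiff hα,
    (holderWith_of_abs_sub_le hf.nonneg hf.iteratedDeriv_abs_sub_le).memHolder⟩

/-- The norm has n + 1 suprema and one seminorm, each at most A. With `HolderTorus.holderBound` this
makes the norm and the best constant in `HolderBound` equivalent. -/
theorem HolderBound.norm_le {α : ℝ≥0} {n : ℕ} {A : ℝ} {f : HolderTorus n α}
    (hf : HolderBound α n A f) : ‖f‖ ≤ (n + 2) * A := by
  rw [HolderTorus.norm_def]
  have h1 : ∑ l ∈ Finset.range (n + 1), (⨆ x, |iteratedDeriv l f x|) ≤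
      ∑ l ∈ Finset.range (n + 1), A :=
    Finset.sum_le_sum fun l hl => ciSup_le fun x =>
      hf.iteratedDeriv_abs_le (by simpa [Nat.lt_succ_iff] using hl) x
  have h2 : (nnHolderNorm α (iteratedDeriv n f) : ℝ) ≤ A := by
    have := (holderWith_of_abs_sub_le hf.nonneg hf.iteratedDeriv_abs_sub_le).nnholderNorm_le
    simpa [hf.nonneg] using NNReal.coe_le_coe.2 this
  simp only [Finset.sum_const, Finset.card_range, nsmul_eq_mul] at h1
  push_cast at h1
  linarith

theorem HolderTorus.holderBound {α : ℝ≥0} {n : ℕ} (f : HolderTorus n α) :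
    HolderBound α n ‖f‖ f := by
  have hs : ∀ l ∈ Finset.range (n + 1), 0 ≤ ⨆ x, |iteratedDeriv l f x| :=
    fun l _ => Real.iSup_nonneg fun x => abs_nonneg _
  have h0 : 0 ≤ (nnHolderNorm α (iteratedDeriv n f) : ℝ) := NNReal.coe_nonneg _
  refine .of_iteratedDeriv f.periodic f.contDiff (fun l hl x => ?_) fun x y => ?_
  · have h1 := Finset.single_le_sum hs (Finset.mem_range.2 (Nat.lt_succ_of_le hl))
    have h2 := le_ciSup (f.bddAbove_iteratedDeriv hl) x
    rw [norm_def]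
    linarith
  · refine (f.memHolder.holderWith.abs_sub_le x y).trans ?_
    gcongr
    rw [norm_def]
    linarith [Finset.sum_nonneg hs]

/-! ### The kernel cot(t/2) and its size. -/

open MeasureTheory in
theorem intervalIntegrable_of_abs_le {F G : ℝ → ℝ} {a b : ℝ} (hab : a ≤ b) (hF : Measurable F)
    (hG : IntervalIntegrable G volume a b) (h : ∀ t ∈ Ioc a b, |F t| ≤ G t) :
    IntervalIntegrable F volume a b := by
  refine hG.mono_fun hF.aestronglyMeasurable ?_
  rw [uIoc_of_le hab]
  filter_upwards [ae_restrict_mem measurableSet_Ioc] with t ht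
  exact (h t ht).trans (le_abs_self _)

open MeasureTheory in
theorem abs_intervalIntegral_le {F G : ℝ → ℝ} {a b : ℝ} (hab : a ≤ b)
    (hG : IntervalIntegrable G volume a b) (h : ∀ t ∈ Ioc a b, |F t| ≤ G t) :
    |∫ t in a..b, F t| ≤ ∫ t in a..b, G t :=
  intervalIntegral.norm_integral_le_of_norm_le (f := F) hab (ae_of_all _ h) hG

/-- The kernel `cot (t / 2)`, written as `sin t / (1 - cos t)`. -/
noncomputable def cotHalf (t : ℝ) : ℝ := Real.sin t / (1 - Real.cos t)

/-- Half-angle formulas. No point is exceptional: where sin(t/2) = 0 both sides are zero by the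
convention for division. -/
theorem inv_tan_half (t : ℝ) : (Real.tan (t / 2))⁻¹ = cotHalf t := by
  have h1 : Real.sin t = 2 * Real.sin (t / 2) * Real.cos (t / 2) := by
    rw [← Real.sin_two_mul]; congr 1; ring
  have h2 : 1 - Real.cos t = 2 * Real.sin (t / 2) ^ 2 := by
    have h0 := Real.cos_sq (t / 2)
    rw [mul_div_cancel₀ t two_ne_zero] at h0
    have h := Real.sin_sq_add_cos_sq (t / 2)
    linarith
  rw [cotHalf, h1, h2, Real.tan_eq_sin_div_cos, inv_div]
  by_cases hs : Real.sin (t / 2) = 0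
  · simp [hs]
  · field_simp

theorem cotHalf_neg (t : ℝ) : cotHalf (-t) = -cotHalf t := by simp [cotHalf, neg_div]

theorem measurable_cotHalf : Measurable cotHalf := by unfold cotHalf; fun_prop

theorem sq_div_five_le_one_sub_cos {t : ℝ} (ht : |t| ≤ Real.pi) : t ^ 2 / 5 ≤ 1 - Real.cos t := by
  have h := Real.cos_le_one_sub_mul_cos_sq ht
  -- The 5 in all kernel bounds comes from π² < 10.
  have h1 : (1 : ℝ) / 5 ≤ 2 / Real.pi ^ 2 := by
    rw [div_le_div_iff₀ (by norm_num) (by positivity)]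
    nlinarith [Real.pi_lt_d2, Real.pi_pos]
  nlinarith [sq_nonneg t]

theorem abs_cotHalf_le {t : ℝ} (h0 : 0 < t) (ht : t ≤ Real.pi) : |cotHalf t| ≤ 5 / t := by
  have h1 := sq_div_five_le_one_sub_cos (t := t) (by rwa [abs_of_pos h0])
  have h2 : |Real.sin t| ≤ t := by simpa [abs_of_pos h0] using Real.abs_sin_le_abs (x := t)
  have h3 : 0 < 1 - Real.cos t := lt_of_lt_of_le (by positivity) h1
  rw [cotHalf, abs_div, abs_of_pos h3, div_le_div_iff₀ h3 h0]
  nlinarith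

theorem intervalIntegrable_const_mul_rpow {α : ℝ} (hα : 0 < α) (C : ℝ) {a b : ℝ} :
    IntervalIntegrable (fun t => C * t ^ (α - 1)) MeasureTheory.volume a b :=
  (intervalIntegral.intervalIntegrable_rpow' (by linarith)).const_mul C

theorem two_mul_rpow_le {α t : ℝ} (hα1 : α < 1) (ht : 0 ≤ t) :
    (2 * t) ^ α ≤ 2 * t ^ α := by
  rw [Real.mul_rpow (by norm_num) ht]
  have : (2 : ℝ) ^ α ≤ 2 := by
    simpa using Real.rpow_le_rpow_of_exponent_le (x := 2) (by norm_num) hα1.le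
  gcongr

/-! ### The Hilbert transform of a Hölder function. -/

namespace HolderBound

variable {α A : ℝ} {f : ℝ → ℝ}

theorem abs_symm_sub_le (hα1 : α < 1) (hf : HolderBound α 0 A f) (x : ℝ) {t : ℝ}
    (h0 : 0 ≤ t) : |f (x - t) - f (x + t)| ≤ 2 * A * t ^ α := by
  have h := hf.abs_sub_le (x - t) (x + t)
  have h1 : |x - t - (x + t)| = 2 * t := by
    rw [show x - t - (x + t) = -(2 * t) by ring, abs_neg, abs_of_nonneg (by linarith)]
  rw [h1] at h
  nlinarith [mul_le_mul_of_nonneg_left (two_mul_rpow_le hα1 h0) hf.nonneg]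

/-- Pairing x - t with x + t cancels the odd singularity: a difference of size t^α against a kernel
of size 1/t is integrable at 0. -/
theorem abs_hilbertIntegrand_le (hα1 : α < 1) (hf : HolderBound α 0 A f) (x : ℝ)
    {t : ℝ} (h0 : 0 < t) (ht : t ≤ Real.pi) :
    |(f (x - t) - f (x + t)) * cotHalf t| ≤ 10 * A * t ^ (α - 1) := by
  rw [abs_mul]
  calc _ ≤ 2 * A * t ^ α * (5 / t) := by
        gcongr
        · exact (abs_nonneg _).trans (hf.abs_symm_sub_le hα1 x h0.le)
        · exact hf.abs_symm_sub_le hα1 x h0.le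
        · exact abs_cotHalf_le h0 ht
    _ = _ := by rw [Real.rpow_sub_one h0.ne']; ring

theorem intervalIntegrable_hilbertIntegrand (hα0 : 0 < α) (hα1 : α < 1)
    (hf : HolderBound α 0 A f) (x : ℝ) :
    IntervalIntegrable (fun t => (f (x - t) - f (x + t)) * cotHalf t) MeasureTheory.volume
      0 Real.pi := by
  have hc := (hf.continuous hα0).measurable
  have hm := measurable_cotHalf
  exact intervalIntegrable_of_abs_le Real.pi_pos.le (by fun_prop)
    (intervalIntegrable_const_mul_rpow hα0 (10 * A))
    fun t ht => hf.abs_hilbertIntegrand_le hα1 x ht.1 ht.2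

/-- The principal value as an absolutely convergent integral. -/
theorem hilbert_eq (hα0 : 0 < α) (hα1 : α < 1) (hf : HolderBound α 0 A f) (x : ℝ) :
    hilbert f x = 1 / (2 * Real.pi) *
      ∫ t in 0..Real.pi, (f (x - t) - f (x + t)) * cotHalf t := by
  have hc := hf.continuous hα0
  have hi := hf.intervalIntegrable_hilbertIntegrand hα0 hα1 x
  -- The limit is shown to exist, so the default value of `limUnder` plays no role. The truncated
  -- integrals are a primitive of an integrable function, continuous up to δ = 0.
  refine Tendsto.limUnder_eq (Tendsto.const_mul _ ?_)
  have h1 : Tendsto (fun δ => ∫ t in δ..Real.pi, (f (x - t) - f (x + t)) * cotHalf t)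
      (𝓝[>] 0) (𝓝 (∫ t in 0..Real.pi, (f (x - t) - f (x + t)) * cotHalf t)) := by
    have h2 : ContinuousOn (fun δ => ∫ t in δ..Real.pi, (f (x - t) - f (x + t)) * cotHalf t)
        (uIcc 0 Real.pi) :=
      intervalIntegral.continuousOn_primitive_interval_left (by
        rw [← intervalIntegrable_iff']; exact hi)
    have h3 := (h2 0 left_mem_uIcc).tendsto
    refine h3.mono_left ?_
    rw [uIcc_of_le Real.pi_pos.le]
    exact nhdsWithin_le_of_mem (Icc_mem_nhdsGT Real.pi_pos)
  refine h1.congr' ?_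
  filter_upwards [Ioo_mem_nhdsGT Real.pi_pos] with δ hδ
  -- For δ > 0 the kernel is continuous, so the two halves are separately integrable and may be
  -- combined.
  have hcont : ContinuousOn cotHalf (uIcc δ Real.pi) := by
    intro t ht
    rw [uIcc_of_le hδ.2.le] at ht
    have ht0 : 0 < t := hδ.1.trans_le ht.1
    have h := sq_div_five_le_one_sub_cos (t := t) (by rw [abs_of_pos ht0]; exact ht.2)
    have h3 : 0 < 1 - Real.cos t := lt_of_lt_of_le (by positivity) h
    exact (Real.continuous_sin.continuousAt.div
      (continuous_const.sub Real.continuous_cos).continuousAt h3.ne').continuousWithinAt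
  have e1 : ∫ y in (x - Real.pi)..(x - δ), f y / Real.tan ((x - y) / 2) =
      ∫ t in δ..Real.pi, f (x - t) * cotHalf t := by
    rw [← intervalIntegral.integral_comp_sub_left (fun y => f y / Real.tan ((x - y) / 2)) x]
    simp only [sub_sub_cancel, div_eq_mul_inv (f _), inv_tan_half]
  have e2 : ∫ y in (x + δ)..(x + Real.pi), f y / Real.tan ((x - y) / 2) =
      -∫ t in δ..Real.pi, f (x + t) * cotHalf t := by
    rw [← intervalIntegral.integral_comp_add_left (fun y => f y / Real.tan ((x - y) / 2)) x,
      ← intervalIntegral.integral_neg]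
    simp only [sub_add_cancel_left, div_eq_mul_inv (f _), inv_tan_half, cotHalf_neg, mul_neg]
  rw [e1, e2, ← sub_eq_add_neg, ← intervalIntegral.integral_sub]
  · simp only [sub_mul]
  · exact ((by fun_prop : Continuous fun t => f (x - t)).continuousOn.mul hcont).intervalIntegrable
  · exact ((by fun_prop : Continuous fun t => f (x + t)).continuousOn.mul hcont).intervalIntegrable

/-- The Hilbert transform is bounded from Hölder functions to bounded functions. -/
theorem abs_hilbert_le (hα0 : 0 < α) (hα1 : α < 1) (hf : HolderBound α 0 A f) (x : ℝ) :
    |hilbert f x| ≤ (1 / (2 * Real.pi) * (10 * ∫ t in 0..Real.pi, t ^ (α - 1))) * A := by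
  rw [hf.hilbert_eq hα0 hα1, abs_mul, abs_of_pos (by positivity), mul_assoc]
  gcongr
  refine (abs_intervalIntegral_le Real.pi_pos.le (intervalIntegrable_const_mul_rpow hα0 (10 * A))
    fun t ht => hf.abs_hilbertIntegrand_le hα1 x ht.1 ht.2).trans (le_of_eq ?_)
  rw [intervalIntegral.integral_const_mul]
  ring

theorem periodic_hilbert (hα0 : 0 < α) (hα1 : α < 1) (hf : HolderBound α 0 A f) :
    Function.Periodic (hilbert f) (2 * Real.pi) := by
  intro x
  rw [hf.hilbert_eq hα0 hα1, hf.hilbert_eq hα0 hα1]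
  congr 1
  refine intervalIntegral.integral_congr fun t _ => ?_
  rw [show x + 2 * Real.pi - t = x - t + 2 * Real.pi by ring,
    show x + 2 * Real.pi + t = x + t + 2 * Real.pi by ring, hf.periodic, hf.periodic]

theorem even_hilbert (hα0 : 0 < α) (hα1 : α < 1) (hf : HolderBound α 0 A f)
    (ho : Function.Odd f) : Function.Even (hilbert f) := by
  intro x
  rw [hf.hilbert_eq hα0 hα1, hf.hilbert_eq hα0 hα1]
  congr 1
  refine intervalIntegral.integral_congr fun t _ => ?_
  rw [show -x - t = -(x + t) by ring, show -x + t = -(x - t) by ring, ho, ho]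
  ring

theorem odd_hilbert (hα0 : 0 < α) (hα1 : α < 1) (hf : HolderBound α 0 A f)
    (he : Function.Even f) : Function.Odd (hilbert f) := by
  intro x
  rw [hf.hilbert_eq hα0 hα1, hf.hilbert_eq hα0 hα1, ← mul_neg, ← intervalIntegral.integral_neg]
  congr 1
  refine intervalIntegral.integral_congr fun t _ => ?_
  rw [show -x - t = -(x + t) by ring, show -x + t = -(x - t) by ring, he, he]
  ring

/-- Differentiation under the integral in `hilbert_eq`; the Hölder bound on f' supplies the
integrable majorant, uniformly in x. -/
theorem hasDerivAt_hilbert (hα0 : 0 < α) (hα1 : α < 1) (hf : HolderBound α 1 A f) (x : ℝ) :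
    HasDerivAt (hilbert f) (hilbert (_root_.deriv f) x) x := by
  have hf0 := hf.of_succ hα0 hα1
  have hd := hf.deriv
  have hm := measurable_cotHalf
  have hc := (hf0.continuous hα0).measurable
  have hc' := (hd.continuous hα0).measurable
  have e : hilbert f = fun x => 1 / (2 * Real.pi) *
      ∫ t in 0..Real.pi, (f (x - t) - f (x + t)) * cotHalf t :=
    funext fun x => hf0.hilbert_eq hα0 hα1 x
  rw [e, hd.hilbert_eq hα0 hα1]
  refine HasDerivAt.const_mul _ ?_
  refine (intervalIntegral.hasDerivAt_integral_of_dominated_loc_of_deriv_le (s := univ)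
    (bound := fun t => 10 * A * t ^ (α - 1))
    (F' := fun x t => (_root_.deriv f (x - t) - _root_.deriv f (x + t)) * cotHalf t)
    univ_mem ?_ (hf0.intervalIntegrable_hilbertIntegrand hα0 hα1 x) ?_ ?_
    (intervalIntegrable_const_mul_rpow hα0 (10 * A)) ?_).2
  · exact Eventually.of_forall fun y => Measurable.aestronglyMeasurable (by fun_prop)
  · exact Measurable.aestronglyMeasurable (by fun_prop)
  · refine MeasureTheory.ae_of_all _ fun t ht y _ => ?_
    rw [uIoc_of_le Real.pi_pos.le] at ht
    exact hd.abs_hilbertIntegrand_le hα1 y ht.1 ht.2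
  · refine MeasureTheory.ae_of_all _ fun t _ y _ => ?_
    exact (((hf.differentiable _).hasDerivAt.comp_sub_const y t).sub
      ((hf.differentiable _).hasDerivAt.comp_add_const y t)).mul_const _

theorem deriv_hilbert (hα0 : 0 < α) (hα1 : α < 1) (hf : HolderBound α 1 A f) :
    _root_.deriv (hilbert f) = hilbert (_root_.deriv f) :=
  funext fun x => (hf.hasDerivAt_hilbert hα0 hα1 x).deriv

end HolderBound

/-! ### Privalov's theorem through a regularised kernel. -/

theorem integrableOn_rpow_div {p : ℝ} (hp0 : -1 < p) (hp1 : p < 1) :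
    MeasureTheory.IntegrableOn (fun s : ℝ => s ^ p / (s ^ 2 + 1)) (Ioi 0) := by
  have hm : Measurable fun s : ℝ => s ^ p / (s ^ 2 + 1) := by fun_prop
  rw [← Ioc_union_Ioi_eq_Ioi zero_le_one]
  refine MeasureTheory.IntegrableOn.union ?_ ?_
  · have h1 : MeasureTheory.IntegrableOn (fun s : ℝ => s ^ p) (Ioc 0 1) :=
      (intervalIntegrable_iff_integrableOn_Ioc_of_le zero_le_one).1
        (intervalIntegral.intervalIntegrable_rpow' hp0)
    refine h1.mono' hm.aestronglyMeasurable ?_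
    filter_upwards [MeasureTheory.ae_restrict_mem measurableSet_Ioc] with s hs
    have h2 : 0 ≤ s ^ p := Real.rpow_nonneg hs.1.le p
    rw [Real.norm_of_nonneg (by positivity)]
    exact div_le_self h2 (by nlinarith [sq_nonneg s])
  · have h1 : MeasureTheory.IntegrableOn (fun s : ℝ => s ^ (p - 2)) (Ioi 1) :=
      integrableOn_Ioi_rpow_of_lt (by linarith) one_pos
    refine h1.mono' hm.aestronglyMeasurable ?_
    filter_upwards [MeasureTheory.ae_restrict_mem measurableSet_Ioi] with s hs
    have hs0 : 0 < s := one_pos.trans hs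
    have h2 : 0 ≤ s ^ p := Real.rpow_nonneg hs0.le p
    rw [Real.norm_of_nonneg (by positivity), Real.rpow_sub hs0, Real.rpow_two]
    gcongr
    linarith

theorem intervalIntegrable_rpow_div {p : ℝ} (hp0 : -1 < p) {δ : ℝ} (hδ : 0 < δ) {b : ℝ} :
    IntervalIntegrable (fun t => t ^ p / (t ^ 2 + δ ^ 2)) MeasureTheory.volume 0 b := by
  have h := intervalIntegral.intervalIntegrable_rpow' (a := 0) (b := b) hp0
  simp only [div_eq_mul_inv]
  refine h.mul_continuousOn (Continuous.continuousOn ?_)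
  exact (by fun_prop : Continuous fun t : ℝ => t ^ 2 + δ ^ 2).inv₀ fun t => by positivity

/-- The substitution t = δs extracts the power of δ. The condition -1 < p < 1 is convergence at 0
and at infinity; it is used with p = α - 1 and p = α. -/
theorem integral_rpow_div_le {p : ℝ} (hp0 : -1 < p) (hp1 : p < 1) {δ b : ℝ} (hδ : 0 < δ)
    (hb : 0 ≤ b) :
    ∫ t in 0..b, t ^ p / (t ^ 2 + δ ^ 2) ≤
      (∫ s in Ioi (0 : ℝ), s ^ p / (s ^ 2 + 1)) * δ ^ (p - 1) := by
  have h1 : ∫ t in 0..b, t ^ p / (t ^ 2 + δ ^ 2) =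
      δ * ∫ s in 0..b / δ, (δ * s) ^ p / ((δ * s) ^ 2 + δ ^ 2) := by
    rw [intervalIntegral.mul_integral_comp_mul_left (f := fun t => t ^ p / (t ^ 2 + δ ^ 2)), mul_zero,
      mul_div_cancel₀ _ hδ.ne']
  have h2 : ∫ s in 0..b / δ, (δ * s) ^ p / ((δ * s) ^ 2 + δ ^ 2) =
      ∫ s in 0..b / δ, δ ^ (p - 2) * (s ^ p / (s ^ 2 + 1)) := by
    refine intervalIntegral.integral_congr fun s hs => ?_
    rw [uIcc_of_le (by positivity)] at hs
    rw [Real.mul_rpow hδ.le hs.1, Real.rpow_sub hδ, Real.rpow_two]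
    field_simp
  have h3 : ∫ s in 0..b / δ, s ^ p / (s ^ 2 + 1) ≤ ∫ s in Ioi (0 : ℝ), s ^ p / (s ^ 2 + 1) := by
    rw [intervalIntegral.integral_of_le (by positivity)]
    refine MeasureTheory.setIntegral_mono_set (integrableOn_rpow_div hp0 hp1) ?_
      (LE.le.eventuallyLE Ioc_subset_Ioi_self)
    filter_upwards [MeasureTheory.ae_restrict_mem measurableSet_Ioi] with s hs
    have : 0 ≤ s ^ p := Real.rpow_nonneg (le_of_lt hs) p
    change 0 ≤ s ^ p / (s ^ 2 + 1)
    positivity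
  have h4 : δ * δ ^ (p - 2) = δ ^ (p - 1) := by
    rw [← Real.rpow_one_add' hδ.le (by linarith)]
    congr 1
    ring
  rw [h1, h2, intervalIntegral.integral_const_mul, ← mul_assoc, h4, mul_comm]
  gcongr

/-- A smooth approximation of `cotHalf`, with singularity removed at scale `δ`. -/
noncomputable def cotHalfReg (δ t : ℝ) : ℝ := Real.sin t / (1 - Real.cos t + δ ^ 2)

/-- The derivative of `cotHalfReg δ`. -/
noncomputable def cotHalfRegDeriv (δ t : ℝ) : ℝ :=
  (Real.cos t - 1 + δ ^ 2 * Real.cos t) / (1 - Real.cos t + δ ^ 2) ^ 2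

section

variable {δ : ℝ}

theorem one_sub_cos_add_sq_pos (hδ : 0 < δ) (t : ℝ) : 0 < 1 - Real.cos t + δ ^ 2 := by
  have := Real.cos_le_one t
  have : 0 < δ ^ 2 := by positivity
  linarith

theorem hasDerivAt_cotHalfReg (hδ : 0 < δ) (t : ℝ) :
    HasDerivAt (cotHalfReg δ) (cotHalfRegDeriv δ t) t := by
  have h := (Real.hasDerivAt_sin t).div
    (((Real.hasDerivAt_cos t).const_sub 1).add_const (δ ^ 2)) (one_sub_cos_add_sq_pos hδ t).ne'
  refine h.congr_deriv ?_
  rw [cotHalfRegDeriv]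
  congr 1
  nlinarith [Real.sin_sq_add_cos_sq t]

theorem continuous_cotHalfReg (hδ : 0 < δ) : Continuous (cotHalfReg δ) :=
  Real.continuous_sin.div (by fun_prop) fun t => (one_sub_cos_add_sq_pos hδ t).ne'

theorem continuous_cotHalfRegDeriv (hδ : 0 < δ) : Continuous (cotHalfRegDeriv δ) :=
  Continuous.div (by fun_prop) (by fun_prop) fun t => (pow_pos (one_sub_cos_add_sq_pos hδ t) 2).ne'

theorem abs_cotHalfRegDeriv_le_inv (hδ : 0 < δ) (t : ℝ) :
    |cotHalfRegDeriv δ t| ≤ 1 / (1 - Real.cos t + δ ^ 2) := by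
  have h := one_sub_cos_add_sq_pos hδ t
  rw [cotHalfRegDeriv, abs_div, abs_of_pos (pow_pos h 2), div_le_div_iff₀ (pow_pos h 2) h]
  have h1 : |Real.cos t - 1 + δ ^ 2 * Real.cos t| ≤ 1 - Real.cos t + δ ^ 2 := by
    have := Real.cos_le_one t
    have := Real.neg_one_le_cos t
    rw [abs_le]
    constructor <;> nlinarith [sq_nonneg δ]
  nlinarith

theorem abs_cotHalfRegDeriv_le (hδ : 0 < δ) {t : ℝ} (ht : |t| ≤ Real.pi) :
    |cotHalfRegDeriv δ t| ≤ 5 / (t ^ 2 + δ ^ 2) := by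
  refine (abs_cotHalfRegDeriv_le_inv hδ t).trans ?_
  rw [div_le_div_iff₀ (one_sub_cos_add_sq_pos hδ t) (by positivity)]
  nlinarith [sq_div_five_le_one_sub_cos ht, sq_nonneg δ]

/-- The error is comparable to 1/t below the scale δ and decays like δ²/t³ above it. The 25 is 5 ·
5, one factor for each denominator. -/
theorem abs_cotHalf_sub_cotHalfReg_le (hδ : 0 < δ) {t : ℝ} (h0 : 0 < t) (ht : t ≤ Real.pi) :
    |cotHalf t - cotHalfReg δ t| ≤ 25 * δ ^ 2 / (t * (t ^ 2 + δ ^ 2)) := by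
  have h1 := sq_div_five_le_one_sub_cos (t := t) (by rwa [abs_of_pos h0])
  have h2 : |Real.sin t| ≤ t := by simpa [abs_of_pos h0] using Real.abs_sin_le_abs (x := t)
  have h3 : 0 < 1 - Real.cos t := lt_of_lt_of_le (by positivity) h1
  have h4 := one_sub_cos_add_sq_pos hδ t
  have e : cotHalf t - cotHalfReg δ t =
      Real.sin t * δ ^ 2 / ((1 - Real.cos t) * (1 - Real.cos t + δ ^ 2)) := by
    rw [cotHalf, cotHalfReg]
    field_simp
    ring
  rw [e, abs_div, abs_mul, abs_of_pos (mul_pos h3 h4), abs_of_pos (pow_pos hδ 2)]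
  calc _ ≤ t * δ ^ 2 / (t ^ 2 / 5 * ((t ^ 2 + δ ^ 2) / 5)) := by
        gcongr
        nlinarith [sq_nonneg δ]
    _ = _ := by field_simp; norm_num

theorem cotHalfReg_neg (δ t : ℝ) : cotHalfReg δ (-t) = -cotHalfReg δ t := by
  simp [cotHalfReg, neg_div]

theorem periodic_cotHalfReg (δ : ℝ) : Function.Periodic (cotHalfReg δ) (2 * Real.pi) := by
  intro t
  simp [cotHalfReg]

/-- The mean-zero property allows a constant to be subtracted from f when it is integrated against
this kernel, which is where Hölder continuity enters `abs_hilbertReg_sub_le`. -/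
theorem integral_cotHalfRegDeriv (hδ : 0 < δ) :
    ∫ t in -Real.pi..Real.pi, cotHalfRegDeriv δ t = 0 := by
  rw [intervalIntegral.integral_eq_sub_of_hasDerivAt
    (fun t _ => hasDerivAt_cotHalfReg hδ t)
    ((continuous_cotHalfRegDeriv hδ).intervalIntegrable _ _)]
  simp [cotHalfReg]

end

open intervalIntegral in
/-- An integral over a symmetric interval, folded onto the positive half. -/
theorem integral_neg_pi_pi_eq {F : ℝ → ℝ} {a : ℝ}
    (h : IntervalIntegrable F MeasureTheory.volume (-a) a) :
    ∫ t in -a..a, F t = ∫ t in 0..a, (F t + F (-t)) := by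
  have h0 : (0 : ℝ) ∈ uIcc (-a) a := by
    rcases le_total 0 a with h | h
    · rw [uIcc_of_le (by linarith)]; exact ⟨by linarith, h⟩
    · rw [uIcc_of_ge (by linarith)]; exact ⟨h, by linarith⟩
  have h1 : IntervalIntegrable F MeasureTheory.volume (-a) 0 :=
    h.mono_set (uIcc_subset_uIcc left_mem_uIcc h0)
  have h2 : IntervalIntegrable F MeasureTheory.volume 0 a :=
    h.mono_set (uIcc_subset_uIcc h0 right_mem_uIcc)
  have h3 : IntervalIntegrable (fun t => F (-t)) MeasureTheory.volume 0 a := by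
    simpa using ((IntervalIntegrable.iff_comp_neg enorm_ne_top).1 h1).symm
  rw [integral_add h2 h3, ← integral_add_adjacent_intervals h1 h2,
    integral_comp_neg fun t => F t]
  simp [add_comm]

/-- Translation and reflection of an integral over a period. -/
theorem integral_period_comp_sub {F : ℝ → ℝ} (hF : Function.Periodic F (2 * Real.pi)) (x : ℝ) :
    ∫ t in -Real.pi..Real.pi, F (x - t) = ∫ y in -Real.pi..Real.pi, F y := by
  rw [intervalIntegral.integral_comp_sub_left F x]
  have h := hF.intervalIntegral_add_eq (x - Real.pi) (-Real.pi)
  rw [show x - Real.pi + 2 * Real.pi = x - -Real.pi by ring,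
    show -Real.pi + 2 * Real.pi = Real.pi by ring] at h
  exact h

/-- The Hilbert transform with regularised kernel. -/
noncomputable def hilbertReg (δ : ℝ) (f : ℝ → ℝ) (x : ℝ) : ℝ :=
  1 / (2 * Real.pi) * ∫ t in 0..Real.pi, (f (x - t) - f (x + t)) * cotHalfReg δ t

namespace HolderBound

variable {α A δ : ℝ} {f : ℝ → ℝ}

/-- The symmetric difference of f, of size t^α, meets the kernel error; by scaling the integral is
δ² · δ^(α - 2). -/
theorem abs_hilbert_sub_hilbertReg_le (hα0 : 0 < α) (hα1 : α < 1) (hδ : 0 < δ)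
    (hf : HolderBound α 0 A f) (x : ℝ) :
    |hilbert f x - hilbertReg δ f x| ≤
      25 / Real.pi * (∫ s in Ioi (0 : ℝ), s ^ (α - 1) / (s ^ 2 + 1)) * A * δ ^ α := by
  have hc := hf.continuous hα0
  have hi : IntervalIntegrable (fun t => (f (x - t) - f (x + t)) * cotHalfReg δ t)
      MeasureTheory.volume 0 Real.pi :=
    (Continuous.mul (by fun_prop) (continuous_cotHalfReg hδ)).intervalIntegrable _ _
  have hA := hf.nonneg
  rw [hf.hilbert_eq hα0 hα1, hilbertReg, ← mul_sub,
    ← intervalIntegral.integral_sub (hf.intervalIntegrable_hilbertIntegrand hα0 hα1 x) hi, abs_mul,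
    abs_of_pos (by positivity)]
  have hle : |∫ t in 0..Real.pi, ((f (x - t) - f (x + t)) * cotHalf t -
      (f (x - t) - f (x + t)) * cotHalfReg δ t)| ≤
      ∫ t in 0..Real.pi, 50 * A * δ ^ 2 * (t ^ (α - 1) / (t ^ 2 + δ ^ 2)) := by
    refine abs_intervalIntegral_le Real.pi_pos.le
      ((intervalIntegrable_rpow_div (by linarith) hδ).const_mul _) fun t ht => ?_
    rw [← mul_sub, abs_mul]
    calc _ ≤ 2 * A * t ^ α * (25 * δ ^ 2 / (t * (t ^ 2 + δ ^ 2))) := by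
          gcongr
          · exact (abs_nonneg _).trans (hf.abs_symm_sub_le hα1 x ht.1.le)
          · exact hf.abs_symm_sub_le hα1 x ht.1.le
          · exact abs_cotHalf_sub_cotHalfReg_le hδ ht.1 ht.2
      _ = _ := by
          have := ht.1
          rw [Real.rpow_sub_one this.ne']
          field_simp
          ring
  rw [intervalIntegral.integral_const_mul] at hle
  have h2 := integral_rpow_div_le (p := α - 1) (by linarith) (by linarith) hδ Real.pi_pos.le
  have h3 : δ ^ 2 * δ ^ (α - 1 - 1) = δ ^ α := by
    rw [← Real.rpow_two, ← Real.rpow_add hδ]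
    congr 1
    ring
  calc _ ≤ 1 / (2 * Real.pi) * (50 * A * δ ^ 2 *
        ((∫ s in Ioi (0 : ℝ), s ^ (α - 1) / (s ^ 2 + 1)) * δ ^ (α - 1 - 1))) := by
        gcongr
        exact hle.trans (by gcongr)
    _ = _ := by
        rw [← h3]
        field_simp
        ring

/-- Without a singularity the folding can be undone and x moved into the kernel, so that an
x-derivative never falls on f. -/
theorem hilbertReg_eq (hδ : 0 < δ) (hp : Function.Periodic f (2 * Real.pi)) (hc : Continuous f)
    (x : ℝ) : hilbertReg δ f x =
      1 / (2 * Real.pi) * ∫ y in -Real.pi..Real.pi, f y * cotHalfReg δ (x - y) := by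
  have hk := continuous_cotHalfReg hδ
  have h1 := integral_period_comp_sub (F := fun y => f y * cotHalfReg δ (x - y)) (by
    intro y
    have h := (periodic_cotHalfReg δ).sub_eq (x - y)
    simp only [hp y]
    rw [show x - (y + 2 * Real.pi) = x - y - 2 * Real.pi by ring, h]) x
  rw [hilbertReg, ← h1, integral_neg_pi_pi_eq (Continuous.intervalIntegrable (by fun_prop) _ _)]
  congr 1
  refine intervalIntegral.integral_congr fun t _ => ?_
  simp only [sub_sub_cancel, sub_neg_eq_add, sub_add_cancel_left, cotHalfReg_neg]
  ring

theorem hasDerivAt_hilbertReg (hδ : 0 < δ) (hp : Function.Periodic f (2 * Real.pi))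
    (hc : Continuous f) (hb : ∀ x, |f x| ≤ A) (x : ℝ) :
    HasDerivAt (hilbertReg δ f)
      (1 / (2 * Real.pi) * ∫ y in -Real.pi..Real.pi, f y * cotHalfRegDeriv δ (x - y)) x := by
  have hk := continuous_cotHalfReg hδ
  have hk' := continuous_cotHalfRegDeriv hδ
  rw [show hilbertReg δ f = _ from funext (hilbertReg_eq hδ hp hc)]
  refine HasDerivAt.const_mul _ ?_
  refine (intervalIntegral.hasDerivAt_integral_of_dominated_loc_of_deriv_le (s := univ)
    (bound := fun _ => A * (1 / δ ^ 2)) (F' := fun x y => f y * cotHalfRegDeriv δ (x - y))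
    univ_mem ?_ (Continuous.intervalIntegrable (by fun_prop) _ _) ?_ ?_ (by simp) ?_).2
  · exact Eventually.of_forall fun y => Continuous.aestronglyMeasurable (by fun_prop)
  · exact Continuous.aestronglyMeasurable (by fun_prop)
  · refine MeasureTheory.ae_of_all _ fun t _ y _ => ?_
    rw [norm_mul]
    refine mul_le_mul (hb t) ((abs_cotHalfRegDeriv_le_inv hδ _).trans ?_) (norm_nonneg _)
      ((abs_nonneg _).trans (hb 0))
    gcongr
    linarith [Real.cos_le_one (y - t)]
  · exact MeasureTheory.ae_of_all _ fun t _ y _ =>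
      ((hasDerivAt_cotHalfReg hδ _).comp_sub_const y t).const_mul _

theorem periodic_cotHalfRegDeriv (δ : ℝ) :
    Function.Periodic (cotHalfRegDeriv δ) (2 * Real.pi) := by
  intro t
  simp [cotHalfRegDeriv]

/-- Mean value inequality. The derivative is the integral of f(z - t) - f(z) against a kernel
bounded by 5/(t² + δ²), hence O(δ^(α - 1)). -/
theorem abs_hilbertReg_sub_le (hα0 : 0 < α) (hα1 : α < 1) (hδ : 0 < δ)
    (hf : HolderBound α 0 A f) (x y : ℝ) :
    |hilbertReg δ f x - hilbertReg δ f y| ≤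
      5 / Real.pi * (∫ s in Ioi (0 : ℝ), s ^ α / (s ^ 2 + 1)) * A * δ ^ (α - 1) * |x - y| := by
  have hc := hf.continuous hα0
  have hA := hf.nonneg
  have hk' := continuous_cotHalfRegDeriv hδ
  refine Convex.norm_image_sub_le_of_norm_hasDerivWithin_le (s := univ)
    (fun z _ => (hasDerivAt_hilbertReg hδ hf.periodic hc hf.abs_le z).hasDerivWithinAt)
    (fun z _ => ?_) convex_univ (mem_univ y) (mem_univ x)
  have h1 := integral_period_comp_sub (F := fun y => f y * cotHalfRegDeriv δ (z - y)) (by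
    intro y
    have h := (periodic_cotHalfRegDeriv δ).sub_eq (z - y)
    simp only [hf.periodic y]
    rw [show z - (y + 2 * Real.pi) = z - y - 2 * Real.pi by ring, h]) z
  have h2 : ∫ t in -Real.pi..Real.pi, f (z - t) * cotHalfRegDeriv δ (z - (z - t)) =
      ∫ t in -Real.pi..Real.pi, (f (z - t) - f z) * cotHalfRegDeriv δ t := by
    simp only [sub_sub_cancel, sub_mul]
    rw [intervalIntegral.integral_sub (Continuous.intervalIntegrable (by fun_prop) _ _)
      (Continuous.intervalIntegrable (by fun_prop) _ _), intervalIntegral.integral_const_mul,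
      integral_cotHalfRegDeriv hδ, mul_zero, sub_zero]
  rw [← h1, h2, integral_neg_pi_pi_eq (Continuous.intervalIntegrable (by fun_prop) _ _), norm_mul,
    Real.norm_of_nonneg (by positivity)]
  have hle : |∫ t in 0..Real.pi, ((f (z - t) - f z) * cotHalfRegDeriv δ t +
      (f (z - -t) - f z) * cotHalfRegDeriv δ (-t))| ≤
      ∫ t in 0..Real.pi, 10 * A * (t ^ α / (t ^ 2 + δ ^ 2)) := by
    refine abs_intervalIntegral_le Real.pi_pos.le
      ((intervalIntegrable_rpow_div (by linarith) hδ).const_mul _) fun t ht => ?_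
    have ha : |t| ≤ Real.pi := by rw [abs_of_pos ht.1]; exact ht.2
    have hk1 := abs_cotHalfRegDeriv_le hδ ha
    have hk2 := abs_cotHalfRegDeriv_le hδ (t := -t) (by rwa [abs_neg])
    rw [neg_sq] at hk2
    have hf1 := hf.abs_sub_le (z - t) z
    have hf2 := hf.abs_sub_le (z - -t) z
    rw [sub_sub_cancel_left, abs_neg, abs_of_pos ht.1] at hf1
    rw [sub_neg_eq_add, add_sub_cancel_left, abs_of_pos ht.1] at hf2
    refine (abs_add_le _ _).trans ?_
    rw [abs_mul, abs_mul, sub_neg_eq_add]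
    calc _ ≤ A * t ^ α * (5 / (t ^ 2 + δ ^ 2)) + A * t ^ α * (5 / (t ^ 2 + δ ^ 2)) := by
          have : 0 ≤ A * t ^ α := (abs_nonneg _).trans hf1
          gcongr
      _ = _ := by ring
  rw [intervalIntegral.integral_const_mul] at hle
  have h3 := integral_rpow_div_le (p := α) (by linarith) hα1 hδ Real.pi_pos.le
  calc _ ≤ 1 / (2 * Real.pi) * (10 * A *
        ((∫ s in Ioi (0 : ℝ), s ^ α / (s ^ 2 + 1)) * δ ^ (α - 1))) := by
        gcongr
        exact hle.trans (by gcongr)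
    _ = _ := by
        field_simp
        ring

end HolderBound

/-- **Privalov's theorem**: the Hilbert transform is bounded on Hölder spaces. -/
theorem exists_holderBound_hilbert {α : ℝ} (hα0 : 0 < α) (hα1 : α < 1) :
    ∃ C, 0 ≤ C ∧ ∀ (n : ℕ) (A : ℝ) (f : ℝ → ℝ), HolderBound α n A f →
      HolderBound α n (C * A) (hilbert f) := by
  set C0 := 1 / (2 * Real.pi) * (10 * ∫ t in 0..Real.pi, t ^ (α - 1)) with hC0
  set C1 := 25 / Real.pi * ∫ s in Ioi (0 : ℝ), s ^ (α - 1) / (s ^ 2 + 1)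
  set C2 := 5 / Real.pi * ∫ s in Ioi (0 : ℝ), s ^ α / (s ^ 2 + 1)
  set C3 := max C0 (2 * C1 + C2)
  have hC0' : 0 ≤ C0 := by
    have : 0 ≤ ∫ t in 0..Real.pi, t ^ (α - 1) :=
      intervalIntegral.integral_nonneg Real.pi_pos.le fun t ht => Real.rpow_nonneg ht.1 _
    positivity
  have hC3 : 0 ≤ C3 := hC0'.trans (le_max_left _ _)
  have h0 : ∀ (A : ℝ) (f : ℝ → ℝ), HolderBound α 0 A f →
      HolderBound α 0 (C3 * A) (hilbert f) := by
    intro A f hf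
    have hA := hf.nonneg
    refine ⟨hf.periodic_hilbert hα0 hα1, fun x => (hf.abs_hilbert_le hα0 hα1 x).trans ?_,
      fun x y => ?_⟩
    · gcongr
      exact le_max_left _ _
    · rcases eq_or_ne x y with rfl | hxy
      · simp [Real.zero_rpow hα0.ne']
      -- Regularise at the scale δ = |x - y|: the two approximation errors and the increment of the
      -- regularised transform are then all O(|x - y|^α).
      have hδ : 0 < |x - y| := abs_pos.2 (sub_ne_zero.2 hxy)
      have h1 := hf.abs_hilbert_sub_hilbertReg_le hα0 hα1 hδ x
      have h2 := hf.abs_hilbert_sub_hilbertReg_le hα0 hα1 hδ y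
      have h3 := hf.abs_hilbertReg_sub_le hα0 hα1 hδ x y
      have h4 : |x - y| ^ (α - 1) * |x - y| = |x - y| ^ α := by
        rw [Real.rpow_sub_one hδ.ne']
        field_simp
      rw [mul_assoc _ (|x - y| ^ (α - 1)), h4] at h3
      have h5 : 2 * C1 + C2 ≤ C3 := le_max_right _ _
      have h6 : (2 * C1 + C2) * A * |x - y| ^ α ≤ C3 * A * |x - y| ^ α := by gcongr
      rw [abs_le] at h1 h2 h3 ⊢
      constructor <;> linarith [h1.1, h1.2, h2.1, h2.2, h3.1, h3.2]
  -- Since H commutes with the derivative, the constant does not grow with n; the 2 pays for reading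
  -- f as an element of C^{0,α}.
  refine ⟨2 * C3, by positivity, fun n => ?_⟩
  induction n with
  | zero =>
    intro A f hf
    exact (h0 A f hf).mono (by nlinarith [mul_nonneg hC3 hf.nonneg])
  | succ n ih =>
    intro A f hf
    have hf1 := hf.of_le hα0 hα1 (m := 1) (by lia)
    have hb := h0 _ f (hf.of_le hα0 hα1 (Nat.zero_le _))
    refine ⟨hb.periodic, fun x => (hf1.hasDerivAt_hilbert hα0 hα1 x).differentiableAt,
      fun x => (hb.abs_le x).trans (le_of_eq (by ring)), ?_⟩
    rw [hf1.deriv_hilbert hα0 hα1]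
    exact ih A _ hf.deriv

/-! ### Smoothing by the commutator. -/

/-- The kernel of the smoothing operator obtained from the commutator of the Hilbert transform
with multiplication by `φ` after an integration by parts. -/
noncomputable def commKernel (φ : ℝ → ℝ) (x t : ℝ) : ℝ :=
  (deriv φ (x - t) * Real.sin t - φ x + φ (x - t)) / (1 - Real.cos t)

/-- The integral operator with kernel `commKernel φ`. -/
noncomputable def commOp (φ G : ℝ → ℝ) (x : ℝ) : ℝ :=
  ∫ t in -Real.pi..Real.pi, commKernel φ x t * G (x - t)

/-- The numerator vanishes at t = 0 and its t-derivative is O(|t|), because the terms free of φ''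
combine to φ'(x - t)(1 - cos t). So it is at most 3At², against a denominator of at least t²/5. -/
theorem abs_commKernel_le {φ : ℝ → ℝ} {A : ℝ} (hφ : Differentiable ℝ φ)
    (hφ' : Differentiable ℝ (deriv φ)) (h1 : ∀ x, |deriv φ x| ≤ A)
    (h2 : ∀ x, |deriv (deriv φ) x| ≤ A) (x : ℝ) {t : ℝ} (ht : |t| ≤ Real.pi) :
    |commKernel φ x t| ≤ 15 * A := by
  have hA : 0 ≤ A := (abs_nonneg _).trans (h1 0)
  rcases eq_or_ne t 0 with rfl | ht0
  · simpa [commKernel] using hA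
  set N : ℝ → ℝ := fun s => deriv φ (x - s) * Real.sin s - φ x + φ (x - s) with hN
  have hd : ∀ s, HasDerivAt N (-deriv (deriv φ) (x - s) * Real.sin s +
      deriv φ (x - s) * Real.cos s + -deriv φ (x - s)) s := fun s =>
    ((((hφ' _).hasDerivAt.comp_const_sub x s).mul (Real.hasDerivAt_sin s)).sub_const (φ x)).add
      ((hφ _).hasDerivAt.comp_const_sub x s)
  have hb : ∀ s ∈ uIcc 0 t, ‖-deriv (deriv φ) (x - s) * Real.sin s +
      deriv φ (x - s) * Real.cos s + -deriv φ (x - s)‖ ≤ 3 * A * |t| := by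
    intro s hs
    have hst : |s| ≤ |t| := by
      have := abs_sub_left_of_mem_uIcc hs
      simpa using this
    have e : -deriv (deriv φ) (x - s) * Real.sin s + deriv φ (x - s) * Real.cos s +
        -deriv φ (x - s) = -(deriv (deriv φ) (x - s) * Real.sin s +
          deriv φ (x - s) * (1 - Real.cos s)) := by ring
    rw [e, norm_neg]
    refine (norm_add_le _ _).trans ?_
    rw [norm_mul, norm_mul]
    have hs1 : ‖Real.sin s‖ ≤ |t| := (Real.abs_sin_le_abs).trans hst
    have hc0 : 0 ≤ 1 - Real.cos s := by linarith [Real.cos_le_one s]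
    -- From 1 - cos s ≤ s²/2 and |t| ≤ π, since π/2 < 2.
    have hc1 : ‖1 - Real.cos s‖ ≤ 2 * |t| := by
      rw [Real.norm_of_nonneg hc0]
      have h3 := Real.one_sub_sq_div_two_le_cos (x := s)
      have h4 : s ^ 2 ≤ |t| ^ 2 := by rw [← sq_abs s]; gcongr
      nlinarith [Real.pi_lt_d2, abs_nonneg t]
    calc _ ≤ A * |t| + A * (2 * |t|) := by
          gcongr
          · exact h2 _
          · exact h1 _
      _ = _ := by ring
  have hle := Convex.norm_image_sub_le_of_norm_hasDerivWithin_le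
    (fun s _ => (hd s).hasDerivWithinAt) hb (convex_uIcc 0 t) left_mem_uIcc right_mem_uIcc
  have hN0 : N 0 = 0 := by simp [hN]
  rw [hN0, sub_zero, sub_zero, Real.norm_eq_abs, Real.norm_eq_abs] at hle
  have h3 := sq_div_five_le_one_sub_cos ht
  have ht2 : 0 < t ^ 2 := by positivity
  have h4 : 0 < 1 - Real.cos t := lt_of_lt_of_le (by positivity) h3
  change |N t / (1 - Real.cos t)| ≤ _
  rw [abs_div, abs_of_pos h4, div_le_iff₀ h4]
  have h5 : 3 * A * |t| * |t| = 3 * A * t ^ 2 := by rw [mul_assoc, abs_mul_abs_self]; ring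
  nlinarith

theorem hasDerivAt_cotHalf {t : ℝ} (ht : 1 - Real.cos t ≠ 0) :
    HasDerivAt cotHalf (-1 / (1 - Real.cos t)) t := by
  have h := (Real.hasDerivAt_sin t).div ((Real.hasDerivAt_cos t).const_sub 1) ht
  refine h.congr_deriv ?_
  rw [div_eq_div_iff (pow_ne_zero 2 ht) ht]
  have h2 : Real.sin t ^ 2 = 1 - Real.cos t ^ 2 := Real.sin_sq t
  linear_combination (Real.cos t - 1) * h2

namespace HolderBound

variable {α A B : ℝ} {φ G : ℝ → ℝ}

theorem measurable_commKernel (hα0 : 0 < α) (hφ : HolderBound α 2 A φ) (x : ℝ) :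
    Measurable (commKernel φ x) := by
  have h1 := (hφ.continuous hα0).measurable
  have h2 := (hφ.deriv.continuous hα0).measurable
  unfold commKernel
  fun_prop

theorem abs_commKernel_le (hφ : HolderBound α 2 A φ) (x : ℝ) {t : ℝ} (ht : |t| ≤ Real.pi) :
    |commKernel φ x t| ≤ 15 * A :=
  _root_.abs_commKernel_le hφ.differentiable hφ.deriv.differentiable hφ.deriv.abs_le
    hφ.deriv.deriv.abs_le x ht

/-- The kernel is linear in φ and commutes with translations, so its increment in x is the kernel of
ψ = φ(· + (x - y)) - φ, whose first two derivatives are at most 2A|x - y|^α. -/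
theorem abs_commKernel_sub_le (hα0 : 0 < α) (hα1 : α < 1) (hφ : HolderBound α 2 A φ) (x y : ℝ)
    {t : ℝ} (ht : |t| ≤ Real.pi) :
    |commKernel φ x t - commKernel φ y t| ≤ 15 * (2 * A * |x - y| ^ α) := by
  have hd := hφ.differentiable
  have hd' := hφ.deriv.differentiable
  set ψ : ℝ → ℝ := fun z => φ (z + (x - y)) - φ z with hψ
  have hψ1 : ∀ z, HasDerivAt ψ (_root_.deriv φ (z + (x - y)) - _root_.deriv φ z) z := fun z =>
    ((hd _).hasDerivAt.comp_add_const z (x - y)).sub (hd z).hasDerivAt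
  have hψ1' : _root_.deriv ψ = fun z => _root_.deriv φ (z + (x - y)) - _root_.deriv φ z :=
    funext fun z => (hψ1 z).deriv
  have hψ2 : ∀ z, HasDerivAt (_root_.deriv ψ)
      (_root_.deriv (_root_.deriv φ) (z + (x - y)) - _root_.deriv (_root_.deriv φ) z) z := fun z => by
    rw [hψ1']
    exact ((hd' _).hasDerivAt.comp_add_const z (x - y)).sub (hd' z).hasDerivAt
  have e : commKernel φ x t - commKernel φ y t = commKernel ψ y t := by
    rw [commKernel, commKernel, commKernel, hψ1', hψ, ← sub_div]
    simp only
    rw [show y - t + (x - y) = x - t by ring, show y + (x - y) = x by ring]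
    ring
  rw [e]
  refine _root_.abs_commKernel_le (fun z => (hψ1 z).differentiableAt)
    (fun z => (hψ2 z).differentiableAt) (fun z => ?_) (fun z => ?_) y ht
  · rw [(hψ1 z).deriv]
    have h := (hφ.deriv.of_succ hα0 hα1).abs_sub_le (z + (x - y)) z
    rwa [add_sub_cancel_left] at h
  · rw [(hψ2 z).deriv]
    have h := hφ.deriv.deriv.abs_sub_le (z + (x - y)) z
    rw [add_sub_cancel_left] at h
    have : 0 ≤ A * |x - y| ^ α := (abs_nonneg _).trans h
    linarith

theorem abs_commKernel_mul_le (hφ : HolderBound α 2 A φ) (hG : HolderBound α 0 B G) (x : ℝ)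
    {t : ℝ} (ht : |t| ≤ Real.pi) : |commKernel φ x t * G (x - t)| ≤ 15 * A * B := by
  rw [abs_mul]
  exact mul_le_mul (hφ.abs_commKernel_le x ht) (hG.abs_le _) (abs_nonneg _)
    (by linarith [hφ.nonneg])

theorem abs_le_pi_of_mem {t : ℝ} (ht : t ∈ Ioc (-Real.pi) Real.pi) : |t| ≤ Real.pi :=
  _root_.abs_le.2 ⟨ht.1.le, ht.2⟩

theorem intervalIntegrable_commKernel_mul (hα0 : 0 < α) (hφ : HolderBound α 2 A φ)
    (hG : HolderBound α 0 B G) (x : ℝ) :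
    IntervalIntegrable (fun t => commKernel φ x t * G (x - t)) MeasureTheory.volume
      (-Real.pi) Real.pi := by
  have h1 := hφ.measurable_commKernel hα0 x
  have h2 := (hG.continuous hα0).measurable
  exact intervalIntegrable_of_abs_le (G := fun _ => 15 * A * B) (by linarith [Real.pi_pos])
    (by fun_prop) (by simp)
    fun t ht => hφ.abs_commKernel_mul_le hG x (abs_le_pi_of_mem ht)

theorem commOp (hα0 : 0 < α) (hα1 : α < 1) (hφ : HolderBound α 2 A φ) (hG : HolderBound α 0 B G) :
    HolderBound α 0 (90 * Real.pi * (A * B)) (commOp φ G) := by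
  have hA := hφ.nonneg
  have hB := hG.nonneg
  have hpi := Real.pi_pos
  refine ⟨fun x => ?_, fun x => ?_, fun x y => ?_⟩
  · refine intervalIntegral.integral_congr fun t _ => ?_
    simp only [commKernel]
    rw [show x + 2 * Real.pi - t = x - t + 2 * Real.pi by ring, hφ.periodic, hφ.periodic,
      hφ.deriv.periodic, hG.periodic]
  · refine (abs_intervalIntegral_le (G := fun _ => 15 * A * B) (by linarith) (by simp)
      fun t ht => hφ.abs_commKernel_mul_le hG x (abs_le_pi_of_mem ht)).trans ?_
    rw [intervalIntegral.integral_const, smul_eq_mul]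
    nlinarith [mul_nonneg hpi.le (mul_nonneg hA hB)]
  · rw [_root_.commOp, _root_.commOp, ← intervalIntegral.integral_sub
      (hφ.intervalIntegrable_commKernel_mul hα0 hG x)
      (hφ.intervalIntegrable_commKernel_mul hα0 hG y)]
    refine (abs_intervalIntegral_le (G := fun _ => 45 * A * B * |x - y| ^ α) (by linarith) (by simp)
      fun t ht => ?_).trans ?_
    · have ht' := abs_le_pi_of_mem ht
      have h1 := hφ.abs_commKernel_sub_le hα0 hα1 x y ht'
      have h2 := hφ.abs_commKernel_le y ht'
      have h3 := hG.abs_le (x - t)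
      have h4 := hG.abs_sub_le (x - t) (y - t)
      rw [sub_sub_sub_cancel_right] at h4
      have e : commKernel φ x t * G (x - t) - commKernel φ y t * G (y - t) =
        (commKernel φ x t - commKernel φ y t) * G (x - t) +
          commKernel φ y t * (G (x - t) - G (y - t)) := by ring
      rw [e]
      refine (abs_add_le _ _).trans ?_
      rw [abs_mul, abs_mul]
      calc _ ≤ 15 * (2 * A * |x - y| ^ α) * B + 15 * A * (B * |x - y| ^ α) := by gcongr
        _ = _ := by ring
    · rw [intervalIntegral.integral_const, smul_eq_mul]
      refine le_of_eq ?_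
      ring

theorem hasDerivAt_commKernel_mul (hφ : HolderBound α 3 A φ) (hG : HolderBound α 1 B G) (x t : ℝ) :
    HasDerivAt (fun x => commKernel φ x t * G (x - t))
      (commKernel (_root_.deriv φ) x t * G (x - t) + commKernel φ x t * _root_.deriv G (x - t)) x := by
  refine HasDerivAt.mul ?_ ((hG.differentiable _).hasDerivAt.comp_sub_const x t)
  refine HasDerivAt.div_const ?_ _
  exact ((((hφ.deriv.differentiable _).hasDerivAt.comp_sub_const x t).mul_const _).sub
    (hφ.differentiable x).hasDerivAt).add ((hφ.differentiable _).hasDerivAt.comp_sub_const x t)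

/-- The dependence on x is by translation only, so the derivative falls on φ or on G and both
resulting terms have the original form. This is what makes C^{3,α} for φ and C^{1,α} for G enough.
-/
theorem hasDerivAt_commOp (hα0 : 0 < α) (hα1 : α < 1) (hφ : HolderBound α 3 A φ)
    (hG : HolderBound α 1 B G) (x : ℝ) :
    HasDerivAt (_root_.commOp φ G)
      (_root_.commOp (_root_.deriv φ) G x + _root_.commOp φ (_root_.deriv G) x) x := by
  have hφ2 := hφ.of_succ hα0 hα1
  have hG0 := hG.of_succ hα0 hα1
  have i1 := hφ.deriv.intervalIntegrable_commKernel_mul hα0 hG0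
  have i2 := hφ2.intervalIntegrable_commKernel_mul hα0 hG.deriv
  rw [_root_.commOp, _root_.commOp, ← intervalIntegral.integral_add (i1 x) (i2 x)]
  refine (intervalIntegral.hasDerivAt_integral_of_dominated_loc_of_deriv_le (s := univ)
    (bound := fun _ => 15 * A * (2 * B) + 15 * (2 * A) * B)
    (F' := fun x t => commKernel (_root_.deriv φ) x t * G (x - t) +
      commKernel φ x t * _root_.deriv G (x - t))
    univ_mem ?_ (hφ2.intervalIntegrable_commKernel_mul hα0 hG0 x) ?_ ?_ (by simp) ?_).2
  · refine Eventually.of_forall fun y => Measurable.aestronglyMeasurable ?_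
    have h1 := hφ2.measurable_commKernel hα0 y
    have h2 := (hG.continuous hα0).measurable
    fun_prop
  · refine Measurable.aestronglyMeasurable ?_
    have h1 := hφ2.measurable_commKernel hα0 x
    have h2 := hφ.deriv.measurable_commKernel hα0 x
    have h3 := (hG.continuous hα0).measurable
    have h4 := (hG.deriv.continuous hα0).measurable
    fun_prop
  · refine MeasureTheory.ae_of_all _ fun t ht y _ => ?_
    rw [uIoc_of_le (by linarith [Real.pi_pos])] at ht
    have ht' := abs_le_pi_of_mem ht
    exact (norm_add_le _ _).trans (add_le_add (hφ.deriv.abs_commKernel_mul_le hG0 y ht')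
      (hφ2.abs_commKernel_mul_le hG.deriv y ht'))
  · exact MeasureTheory.ae_of_all _ fun t _ y _ => hφ.hasDerivAt_commKernel_mul hG y t

/-- Integration by parts turns the commutator applied to a derivative into `commOp`. -/
theorem hilbertCommutator_deriv (hα0 : 0 < α) (hα1 : α < 1) (hφ : HolderBound α 2 A φ)
    (hG : HolderBound α 1 B G) (x : ℝ) :
    hilbertCommutator φ (_root_.deriv G) x = -(1 / (2 * Real.pi)) * _root_.commOp φ G x := by
  have hφ0 := hφ.of_le hα0 hα1 (Nat.zero_le _)
  have hg := hG.deriv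
  have hG0 := hG.of_succ hα0 hα1
  have hφg := hφ0.mul hα0 hα1 hg
  have j1 := hφg.intervalIntegrable_hilbertIntegrand hα0 hα1 x
  have j2 := (hg.intervalIntegrable_hilbertIntegrand hα0 hα1 x).const_mul (φ x)
  have i0 := hφ.intervalIntegrable_commKernel_mul hα0 hG0 x
  -- `E t * cotHalf t` is the boundary term of the integration by parts, symmetrised in t; `I` below
  -- is the commutator integrand and `M` the folded kernel integrand.
  set E : ℝ → ℝ := fun t => (φ (x - t) - φ x) * G (x - t) + (φ (x + t) - φ x) * G (x + t) with hE
  have hEd : ∀ t, HasDerivAt E ((-_root_.deriv φ (x - t)) * G (x - t) +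
      (φ (x - t) - φ x) * (-_root_.deriv G (x - t)) +
      (_root_.deriv φ (x + t) * G (x + t) + (φ (x + t) - φ x) * _root_.deriv G (x + t))) t := fun t =>
    ((((hφ.differentiable _).hasDerivAt.comp_const_sub x t).sub_const _).mul
      ((hG.differentiable _).hasDerivAt.comp_const_sub x t)).add
    ((((hφ.differentiable _).hasDerivAt.comp_const_add x t).sub_const _).mul
      ((hG.differentiable _).hasDerivAt.comp_const_add x t))
  set I : ℝ → ℝ := fun t => (φ (x - t) * _root_.deriv G (x - t) -
    φ (x + t) * _root_.deriv G (x + t)) * cotHalf t - φ x *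
      ((_root_.deriv G (x - t) - _root_.deriv G (x + t)) * cotHalf t) with hI
  set M : ℝ → ℝ := fun t => commKernel φ x t * G (x - t) +
    commKernel φ x (-t) * G (x - -t) with hM
  have hne : ∀ t, 0 < t → t ≤ Real.pi → 1 - Real.cos t ≠ 0 := by
    intro t h0 ht
    have h := sq_div_five_le_one_sub_cos (t := t) (by rwa [abs_of_pos h0])
    exact (lt_of_lt_of_le (by positivity) h).ne'
  have hPd : ∀ t, 0 < t → t ≤ Real.pi →
      HasDerivAt (fun t => E t * cotHalf t) (-(I t + M t)) t := by
    intro t h0 ht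
    refine ((hEd t).mul (hasDerivAt_cotHalf (hne t h0 ht))).congr_deriv ?_
    have := hne t h0 ht
    simp only [hE, hI, hM, commKernel, cotHalf, Real.sin_neg, Real.cos_neg, sub_neg_eq_add]
    field_simp
    ring
  have hIi : IntervalIntegrable I MeasureTheory.volume 0 Real.pi := j1.sub j2
  have hMi : IntervalIntegrable M MeasureTheory.volume 0 Real.pi := by
    have h1 : IntervalIntegrable (fun t => commKernel φ x t * G (x - t)) MeasureTheory.volume
        0 Real.pi := i0.mono_set (uIcc_subset_uIcc
          (by rw [uIcc_of_le (by linarith [Real.pi_pos])]; constructor <;> linarith [Real.pi_pos])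
          right_mem_uIcc)
    have h2 : IntervalIntegrable (fun t => commKernel φ x t * G (x - t)) MeasureTheory.volume
        (-Real.pi) 0 := i0.mono_set (uIcc_subset_uIcc left_mem_uIcc
          (by rw [uIcc_of_le (by linarith [Real.pi_pos])]; constructor <;> linarith [Real.pi_pos]))
    have h3 := ((IntervalIntegrable.iff_comp_neg enorm_ne_top).1 h2).symm
    rw [neg_neg, neg_zero] at h3
    exact h1.add h3
  -- Both E(0) and E'(0) vanish, the latter by the symmetrisation, so E(t) = o(t) beats the 1/t
  -- singularity.
  have l0 : Tendsto (fun t => E t * cotHalf t) (𝓝[>] 0) (𝓝 0) := by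
    have h1 := (hEd 0).tendsto_slope_zero
    have e0 : E 0 = 0 := by simp [hE]
    simp only [sub_zero, add_zero, zero_add, e0, smul_eq_mul, sub_self, zero_mul] at h1
    rw [show -_root_.deriv φ x * G x + _root_.deriv φ x * G x = 0 by ring] at h1
    have h2 : Tendsto (fun t => 5 * |t⁻¹ * E t|) (𝓝[>] 0) (𝓝 0) := by
      have := (h1.mono_left (nhdsWithin_mono 0 fun t (ht : t ∈ Ioi (0 : ℝ)) => ne_of_gt ht)).abs.const_mul 5
      simpa using this
    refine squeeze_zero_norm' ?_ h2
    filter_upwards [Ioo_mem_nhdsGT Real.pi_pos] with t ht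
    rw [norm_mul, abs_mul, abs_inv, abs_of_pos ht.1]
    calc ‖E t‖ * ‖cotHalf t‖ ≤ ‖E t‖ * (5 / t) := by
          gcongr
          exact abs_cotHalf_le ht.1 ht.2.le
      _ = _ := by rw [Real.norm_eq_abs]; ring
  have lpi : Tendsto (fun t => E t * cotHalf t) (𝓝[<] Real.pi) (𝓝 0) := by
    have h1 := (hPd Real.pi Real.pi_pos le_rfl).continuousAt.tendsto
    have e0 : cotHalf Real.pi = 0 := by simp [cotHalf]
    rw [e0, mul_zero] at h1
    exact h1.mono_left nhdsWithin_le_nhds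
  have key := intervalIntegral.integral_eq_sub_of_hasDerivAt_of_tendsto Real.pi_pos
    (fun t ht => hPd t ht.1 ht.2.le) (hIi.add hMi).neg l0 lpi
  rw [intervalIntegral.integral_neg, intervalIntegral.integral_add hIi hMi, sub_zero,
    neg_eq_zero] at key
  have e1 : ∫ t in 0..Real.pi, I t = (∫ t in 0..Real.pi, (φ (x - t) * _root_.deriv G (x - t) -
      φ (x + t) * _root_.deriv G (x + t)) * cotHalf t) - φ x *
      ∫ t in 0..Real.pi, (_root_.deriv G (x - t) - _root_.deriv G (x + t)) * cotHalf t := by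
    rw [← intervalIntegral.integral_const_mul, ← intervalIntegral.integral_sub j1 j2]
  rw [hilbertCommutator, hφg.hilbert_eq hα0 hα1, hg.hilbert_eq hα0 hα1, _root_.commOp,
    integral_neg_pi_pi_eq i0]
  rw [e1] at key
  linear_combination (1 / (2 * Real.pi)) * key

/-- Smoothing property of the commutator: no derivative of `G` beyond the first is needed. -/
theorem hilbertCommutator (hα0 : 0 < α) (hα1 : α < 1) (hφ : HolderBound α 3 A φ)
    (hG : HolderBound α 1 B G) :
    HolderBound α 1 (180 * (A * B)) (hilbertCommutator φ (_root_.deriv G)) := by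
  have hφ2 := hφ.of_succ hα0 hα1
  have hG0 := hG.of_succ hα0 hα1
  rw [funext (hφ2.hilbertCommutator_deriv hα0 hα1 hG)]
  have hd : _root_.deriv (_root_.commOp φ G) =
      fun x => _root_.commOp (_root_.deriv φ) G x + _root_.commOp φ (_root_.deriv G) x :=
    funext fun x => (hφ.hasDerivAt_commOp hα0 hα1 hG x).deriv
  -- Each of the two terms of the derivative contributes 180π, one with B doubled and the other with
  -- A doubled by lowering an order.
  have h1 : HolderBound α 1 (360 * Real.pi * (A * B)) (_root_.commOp φ G) := by
    have h0 := hφ2.commOp hα0 hα1 hG0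
    refine ⟨h0.periodic, fun x => (hφ.hasDerivAt_commOp hα0 hα1 hG x).differentiableAt,
      fun x => (h0.abs_le x).trans (le_of_eq (by ring)), ?_⟩
    rw [hd]
    exact ((hφ.deriv.commOp hα0 hα1 hG0).add (hφ2.commOp hα0 hα1 hG.deriv)).mono
      (le_of_eq (by ring))
  refine (h1.const_mul _).mono (le_of_eq ?_)
  rw [abs_neg, abs_of_pos (by positivity)]
  field_simp
  ring

end HolderBound

/-! ### Real Fourier coefficients. -/

/-- The `k`-th Fourier cosine coefficient. -/
noncomputable def cosCoeff (f : ℝ → ℝ) (k : ℕ) : ℝ :=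
  1 / Real.pi * ∫ x in -Real.pi..Real.pi, f x * Real.cos (k * x)

/-- The `k`-th Fourier sine coefficient. -/
noncomputable def sinCoeff (f : ℝ → ℝ) (k : ℕ) : ℝ :=
  1 / Real.pi * ∫ x in -Real.pi..Real.pi, f x * Real.sin (k * x)

theorem cos_nat_mul_add_two_pi (k : ℕ) (x : ℝ) :
    Real.cos (k * (x + 2 * Real.pi)) = Real.cos (k * x) := by
  rw [mul_add, Real.cos_add_nat_mul_two_pi]

theorem sin_nat_mul_add_two_pi (k : ℕ) (x : ℝ) :
    Real.sin (k * (x + 2 * Real.pi)) = Real.sin (k * x) := by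
  rw [mul_add, Real.sin_add_nat_mul_two_pi]

theorem hasDerivAt_cos_mul (c x : ℝ) :
    HasDerivAt (fun x => Real.cos (c * x)) (-c * Real.sin (c * x)) x := by
  have h := ((hasDerivAt_id x).const_mul c).cos
  refine h.congr_deriv ?_
  simp
  ring

theorem hasDerivAt_sin_mul (c x : ℝ) :
    HasDerivAt (fun x => Real.sin (c * x)) (c * Real.cos (c * x)) x := by
  have h := ((hasDerivAt_id x).const_mul c).sin
  refine h.congr_deriv ?_
  simp
  ring

theorem integral_deriv_mul_of_periodic {f f' e e' : ℝ → ℝ} (hf : ∀ x, HasDerivAt f (f' x) x)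
    (he : ∀ x, HasDerivAt e (e' x) x) (hf' : Continuous f') (he' : Continuous e')
    (hpf : Function.Periodic f (2 * Real.pi)) (hpe : Function.Periodic e (2 * Real.pi)) :
    ∫ x in -Real.pi..Real.pi, f' x * e x = -∫ x in -Real.pi..Real.pi, f x * e' x := by
  have h1 : f Real.pi = f (-Real.pi) := by
    have := hpf (-Real.pi)
    rwa [show -Real.pi + 2 * Real.pi = Real.pi by ring] at this
  have h2 : e Real.pi = e (-Real.pi) := by
    have := hpe (-Real.pi)
    rwa [show -Real.pi + 2 * Real.pi = Real.pi by ring] at this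
  have h := intervalIntegral.integral_mul_deriv_eq_deriv_mul (a := -Real.pi) (b := Real.pi)
    (fun x _ => hf x) (fun x _ => he x) (hf'.intervalIntegrable _ _) (he'.intervalIntegrable _ _)
  rw [h1, h2, sub_self] at h
  rw [h]
  ring

section deriv

variable {f f' : ℝ → ℝ}

theorem cosCoeff_deriv (hf : ∀ x, HasDerivAt f (f' x) x) (hf' : Continuous f')
    (hp : Function.Periodic f (2 * Real.pi)) (k : ℕ) : cosCoeff f' k = k * sinCoeff f k := by
  rw [cosCoeff, sinCoeff, integral_deriv_mul_of_periodic hf (hasDerivAt_cos_mul k) hf'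
    (by fun_prop) hp (cos_nat_mul_add_two_pi k), ← intervalIntegral.integral_neg]
  rw [mul_left_comm, ← intervalIntegral.integral_const_mul (k : ℝ)]
  congr 1
  refine intervalIntegral.integral_congr fun x _ => ?_
  ring

theorem sinCoeff_deriv (hf : ∀ x, HasDerivAt f (f' x) x) (hf' : Continuous f')
    (hp : Function.Periodic f (2 * Real.pi)) (k : ℕ) : sinCoeff f' k = -k * cosCoeff f k := by
  rw [cosCoeff, sinCoeff, integral_deriv_mul_of_periodic hf (hasDerivAt_sin_mul k) hf'
    (by fun_prop) hp (sin_nat_mul_add_two_pi k), ← intervalIntegral.integral_neg]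
  rw [mul_left_comm, ← intervalIntegral.integral_const_mul (-k : ℝ)]
  congr 1
  refine intervalIntegral.integral_congr fun x _ => ?_
  ring

end deriv

section linear

variable {f g : ℝ → ℝ}

theorem cosCoeff_add (hf : Continuous f) (hg : Continuous g) (k : ℕ) :
    cosCoeff (fun x => f x + g x) k = cosCoeff f k + cosCoeff g k := by
  simp only [cosCoeff, add_mul]
  rw [intervalIntegral.integral_add (Continuous.intervalIntegrable (by fun_prop) _ _)
    (Continuous.intervalIntegrable (by fun_prop) _ _), mul_add]

theorem sinCoeff_add (hf : Continuous f) (hg : Continuous g) (k : ℕ) :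
    sinCoeff (fun x => f x + g x) k = sinCoeff f k + sinCoeff g k := by
  simp only [sinCoeff, add_mul]
  rw [intervalIntegral.integral_add (Continuous.intervalIntegrable (by fun_prop) _ _)
    (Continuous.intervalIntegrable (by fun_prop) _ _), mul_add]

theorem cosCoeff_const_mul (c : ℝ) (f : ℝ → ℝ) (k : ℕ) :
    cosCoeff (fun x => c * f x) k = c * cosCoeff f k := by
  simp only [cosCoeff, mul_assoc, intervalIntegral.integral_const_mul]
  ring

theorem sinCoeff_const_mul (c : ℝ) (f : ℝ → ℝ) (k : ℕ) :
    sinCoeff (fun x => c * f x) k = c * sinCoeff f k := by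
  simp only [sinCoeff, mul_assoc, intervalIntegral.integral_const_mul]
  ring

theorem integral_eq_zero_of_odd (hf : Function.Odd f) :
    ∫ x in -Real.pi..Real.pi, f x = 0 := by
  have h := intervalIntegral.integral_comp_neg (a := -Real.pi) (b := Real.pi) f
  simp only [hf _, intervalIntegral.integral_neg, neg_neg] at h
  linarith

theorem cosCoeff_eq_zero_of_odd (hf : Function.Odd f) (k : ℕ) : cosCoeff f k = 0 := by
  rw [cosCoeff, integral_eq_zero_of_odd fun x => by rw [hf, mul_neg, Real.cos_neg, neg_mul],
    mul_zero]

theorem sinCoeff_eq_zero_of_even (hf : Function.Even f) (k : ℕ) : sinCoeff f k = 0 := by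
  rw [sinCoeff, integral_eq_zero_of_odd fun x => by rw [hf, mul_neg, Real.sin_neg, mul_neg],
    mul_zero]

theorem abs_cosCoeff_le {A : ℝ} (hf : ∀ x, |f x| ≤ A) (k : ℕ) : |cosCoeff f k| ≤ 2 * A := by
  rw [cosCoeff, abs_mul, abs_of_pos (by positivity)]
  have h := intervalIntegral.norm_integral_le_of_norm_le_const (a := -Real.pi) (b := Real.pi)
    (f := fun x => f x * Real.cos (k * x)) (C := A) fun x _ => by
      rw [norm_mul]
      exact (mul_le_of_le_one_right (norm_nonneg _) (Real.abs_cos_le_one _)).trans (hf x)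
  rw [sub_neg_eq_add, abs_of_pos (by positivity), Real.norm_eq_abs] at h
  rw [one_div, inv_mul_le_iff₀ Real.pi_pos]
  linarith

end linear

section orthogonality

/-- Integrating by parts in both ways shows that j² - k² annihilates the coefficient, as for
eigenfunctions of a symmetric operator. -/
theorem cosCoeff_cos_of_ne {j k : ℕ} (h : j ≠ k) :
    cosCoeff (fun x => Real.cos (j * x)) k = 0 := by
  have h1 := sinCoeff_deriv (hasDerivAt_cos_mul j) (by fun_prop) (cos_nat_mul_add_two_pi j) k
  have h2 := cosCoeff_deriv (hasDerivAt_sin_mul j) (by fun_prop) (sin_nat_mul_add_two_pi j) k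
  rw [sinCoeff_const_mul] at h1
  rw [cosCoeff_const_mul] at h2
  have h3 : ((j : ℝ) ^ 2 - (k : ℝ) ^ 2) * cosCoeff (fun x => Real.cos (j * x)) k = 0 := by
    linear_combination (j : ℝ) * h2 - (k : ℝ) * h1
  refine (mul_eq_zero.1 h3).resolve_left fun h4 => h ?_
  have h5 : (j : ℝ) ^ 2 = (k : ℝ) ^ 2 := by linarith
  have h6 : (j : ℝ) = k := (sq_eq_sq₀ (by positivity) (by positivity)).1 h5
  exact_mod_cast h6

theorem sinCoeff_sin_of_ne {j k : ℕ} (h : j ≠ k) :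
    sinCoeff (fun x => Real.sin (j * x)) k = 0 := by
  have h1 := cosCoeff_deriv (hasDerivAt_sin_mul j) (by fun_prop) (sin_nat_mul_add_two_pi j) k
  have h2 := sinCoeff_deriv (hasDerivAt_cos_mul j) (by fun_prop) (cos_nat_mul_add_two_pi j) k
  rw [cosCoeff_const_mul] at h1
  rw [sinCoeff_const_mul] at h2
  have h3 : ((j : ℝ) ^ 2 - (k : ℝ) ^ 2) * sinCoeff (fun x => Real.sin (j * x)) k = 0 := by
    linear_combination -(j : ℝ) * h2 + (k : ℝ) * h1
  refine (mul_eq_zero.1 h3).resolve_left fun h4 => h ?_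
  have h5 : (j : ℝ) ^ 2 = (k : ℝ) ^ 2 := by linarith
  have h6 : (j : ℝ) = k := (sq_eq_sq₀ (by positivity) (by positivity)).1 h5
  exact_mod_cast h6

theorem integral_cos_sq_add_integral_sin_sq (k : ℕ) :
    cosCoeff (fun x => Real.cos (k * x)) k + sinCoeff (fun x => Real.sin (k * x)) k = 2 := by
  rw [cosCoeff, sinCoeff, ← mul_add, ← intervalIntegral.integral_add
    (Continuous.intervalIntegrable (by fun_prop) _ _)
    (Continuous.intervalIntegrable (by fun_prop) _ _)]
  have : ∀ x : ℝ, Real.cos (k * x) * Real.cos (k * x) + Real.sin (k * x) * Real.sin (k * x) = 1 :=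
    fun x => by nlinarith [Real.sin_sq_add_cos_sq (k * x)]
  simp only [this, intervalIntegral.integral_const, smul_eq_mul]
  field_simp
  ring

/-- Integration by parts equates the integrals of cos² and sin² when k ≠ 0, and their normalised sum
is 2. -/
theorem cosCoeff_cos_self {k : ℕ} (hk : k ≠ 0) :
    cosCoeff (fun x => Real.cos (k * x)) k = 1 := by
  have h1 := cosCoeff_deriv (hasDerivAt_sin_mul k) (by fun_prop) (sin_nat_mul_add_two_pi k) k
  rw [cosCoeff_const_mul] at h1
  have h2 := mul_left_cancel₀ (Nat.cast_ne_zero.2 hk) h1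
  linarith [integral_cos_sq_add_integral_sin_sq k]

theorem sinCoeff_sin_self {k : ℕ} (hk : k ≠ 0) :
    sinCoeff (fun x => Real.sin (k * x)) k = 1 := by
  linarith [integral_cos_sq_add_integral_sin_sq k, cosCoeff_cos_self hk]

end orthogonality

section series

variable {f : ℝ → ℝ} {a : ℕ → ℝ}

theorem cosCoeff_eq_tsum {u : ℕ → ℝ → ℝ} (hu : ∀ j, Continuous (u j)) (hb : ∀ j x, |u j x| ≤ |a j|)
    (ha : Summable a) (hf : ∀ x, HasSum (fun j => u j x) (f x)) (k : ℕ) :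
    HasSum (fun j => cosCoeff (u j) k) (cosCoeff f k) := by
  refine HasSum.mul_left _ ?_
  refine intervalIntegral.hasSum_integral_of_dominated_convergence (fun j _ => |a j|)
    (fun j => Continuous.aestronglyMeasurable (by have := hu j; fun_prop)) (fun j => ?_) ?_
    (by simp) ?_
  · refine MeasureTheory.ae_of_all _ fun x _ => ?_
    rw [norm_mul]
    exact (mul_le_of_le_one_right (norm_nonneg _) (Real.abs_cos_le_one _)).trans (hb j x)
  · exact MeasureTheory.ae_of_all _ fun x _ => ha.abs
  · exact MeasureTheory.ae_of_all _ fun x _ => (hf x).mul_right _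

theorem sinCoeff_eq_tsum {u : ℕ → ℝ → ℝ} (hu : ∀ j, Continuous (u j)) (hb : ∀ j x, |u j x| ≤ |a j|)
    (ha : Summable a) (hf : ∀ x, HasSum (fun j => u j x) (f x)) (k : ℕ) :
    HasSum (fun j => sinCoeff (u j) k) (sinCoeff f k) := by
  refine HasSum.mul_left _ ?_
  refine intervalIntegral.hasSum_integral_of_dominated_convergence (fun j _ => |a j|)
    (fun j => Continuous.aestronglyMeasurable (by have := hu j; fun_prop)) (fun j => ?_) ?_
    (by simp) ?_
  · refine MeasureTheory.ae_of_all _ fun x _ => ?_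
    rw [norm_mul]
    exact (mul_le_of_le_one_right (norm_nonneg _) (Real.abs_sin_le_one _)).trans (hb j x)
  · exact MeasureTheory.ae_of_all _ fun x _ => ha.abs
  · exact MeasureTheory.ae_of_all _ fun x _ => (hf x).mul_right _

/-- Integrate termwise and use orthogonality. Any sequence witnessing membership in `spaceX` is
thereby the sequence of Fourier coefficients. -/
theorem cosCoeff_succ_of_hasSum (ha : Summable a)
    (hf : ∀ x : ℝ, HasSum (fun k : ℕ => a k * Real.cos ((k + 1) * x)) (f x)) (k : ℕ) :
    cosCoeff f (k + 1) = a k := by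
  have h := cosCoeff_eq_tsum (u := fun j x => a j * Real.cos ((j + 1) * x))
    (fun j => by fun_prop) (fun j x => by
      rw [abs_mul]
      exact mul_le_of_le_one_right (abs_nonneg _) (Real.abs_cos_le_one _)) ha hf (k + 1)
  refine h.unique ?_
  have e : cosCoeff (fun x => a k * Real.cos ((k + 1) * x)) (k + 1) = a k := by
    have := cosCoeff_cos_self (k := k + 1) (by lia)
    push_cast at this
    rw [cosCoeff_const_mul, this, mul_one]
  rw [← e]
  refine hasSum_single (f := fun j : ℕ => cosCoeff (fun x => a j * Real.cos ((j + 1) * x)) (k + 1))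
    k fun j hj => ?_
  · have := cosCoeff_cos_of_ne (j := j + 1) (k := k + 1) (by lia)
    push_cast at this
    rw [cosCoeff_const_mul, this, mul_zero]

theorem sinCoeff_succ_of_hasSum (ha : Summable a)
    (hf : ∀ x : ℝ, HasSum (fun k : ℕ => a k * Real.sin ((k + 1) * x)) (f x)) (k : ℕ) :
    sinCoeff f (k + 1) = a k := by
  have h := sinCoeff_eq_tsum (u := fun j x => a j * Real.sin ((j + 1) * x))
    (fun j => by fun_prop) (fun j x => by
      rw [abs_mul]
      exact mul_le_of_le_one_right (abs_nonneg _) (Real.abs_sin_le_one _)) ha hf (k + 1)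
  refine h.unique ?_
  have e : sinCoeff (fun x => a k * Real.sin ((k + 1) * x)) (k + 1) = a k := by
    have := sinCoeff_sin_self (k := k + 1) (by lia)
    push_cast at this
    rw [sinCoeff_const_mul, this, mul_one]
  rw [← e]
  refine hasSum_single (f := fun j : ℕ => sinCoeff (fun x => a j * Real.sin ((j + 1) * x)) (k + 1))
    k fun j hj => ?_
  · have := sinCoeff_sin_of_ne (j := j + 1) (k := k + 1) (by lia)
    push_cast at this
    rw [sinCoeff_const_mul, this, mul_zero]

end series

/-! ### Absolute convergence of Fourier series. -/

section complexCoefficients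

open Complex in
theorem fourierCoeff_eq {f : ℝ → ℝ} (hf : Continuous f) [Fact (0 < 2 * Real.pi)]
    {F : AddCircle (2 * Real.pi) → ℂ} (hF : ∀ x : ℝ, F x = f x) (n : ℕ) :
    fourierCoeff F n = (cosCoeff f n - sinCoeff f n * I) / 2 ∧
      fourierCoeff F (-n) = (cosCoeff f n + sinCoeff f n * I) / 2 := by
  have e : ∀ (m : ℤ) (x : ℝ), fourier (-m) (x : AddCircle (2 * Real.pi)) • F x =
      ((f x * Real.cos (m * x) : ℝ) : ℂ) - ((f x * Real.sin (m * x) : ℝ) : ℂ) * I := by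
    intro m x
    rw [fourier_coe_apply, hF, smul_eq_mul]
    have : 2 * (Real.pi : ℂ) * I * ((-m : ℤ) : ℂ) * x / ((2 * Real.pi : ℝ) : ℂ) =
        -((m * x : ℝ) : ℂ) * I := by
      have : (Real.pi : ℂ) ≠ 0 := by exact_mod_cast Real.pi_ne_zero
      push_cast
      field_simp
    rw [this, exp_mul_I, Complex.cos_neg, Complex.sin_neg]
    push_cast
    ring
  have key : ∀ m : ℤ, fourierCoeff F m =
      ((1 / Real.pi * ∫ x in -Real.pi..Real.pi, f x * Real.cos (m * x) : ℝ) -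
        (1 / Real.pi * ∫ x in -Real.pi..Real.pi, f x * Real.sin (m * x) : ℝ) * I) / 2 := by
    intro m
    rw [fourierCoeff_eq_intervalIntegral F m (-Real.pi)]
    simp only [e]
    rw [intervalIntegral.integral_sub (Continuous.intervalIntegrable (by fun_prop) _ _)
      (Continuous.intervalIntegrable (by fun_prop) _ _), intervalIntegral.integral_mul_const,
      intervalIntegral.integral_ofReal, intervalIntegral.integral_ofReal,
      show -Real.pi + 2 * Real.pi = Real.pi by ring]
    have : (Real.pi : ℂ) ≠ 0 := by exact_mod_cast Real.pi_ne_zero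
    rw [Complex.real_smul]
    push_cast
    field_simp
  constructor
  · rw [key]
    simp [cosCoeff, sinCoeff]
  · rw [key]
    simp only [cosCoeff, sinCoeff]
    push_cast
    simp only [neg_mul, Real.cos_neg, Real.sin_neg, mul_neg, intervalIntegral.integral_neg]
    push_cast
    ring

end complexCoefficients

open MeasureTheory in
-- Parseval on the circle, where the squared modulus of the n-th complex coefficient is a quarter of
-- the sum of the two real squares.
theorem summable_sq_fourierCoeffs {f : ℝ → ℝ} (hf : Continuous f)
    (hp : Function.Periodic f (2 * Real.pi)) :
    Summable (fun k => cosCoeff f k ^ 2) ∧ Summable (fun k => sinCoeff f k ^ 2) := by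
  have : Fact (0 < 2 * Real.pi) := ⟨by positivity⟩
  have hpc : Function.Periodic (fun x => (f x : ℂ)) (2 * Real.pi) := fun x => by simp only [hp x]
  let F : C(AddCircle (2 * Real.pi), ℂ) :=
    ⟨hpc.lift, (by fun_prop : Continuous fun x => (f x : ℂ)).quotient_lift _⟩
  have hF : ∀ x : ℝ, F x = f x := fun x => rfl
  have h := (hasSum_sq_fourierCoeff (ContinuousMap.toLp (E := ℂ) 2 AddCircle.haarAddCircle ℂ F)).summable
  simp only [fourierCoeff_toLp] at h
  have h1 : Summable fun n : ℕ => ‖fourierCoeff F (n : ℤ)‖ ^ 2 :=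
    h.comp_injective Nat.cast_injective
  have e : ∀ n : ℕ, ‖fourierCoeff F (n : ℤ)‖ ^ 2 = (cosCoeff f n ^ 2 + sinCoeff f n ^ 2) / 4 := by
    intro n
    rw [(fourierCoeff_eq hf hF n).1, ← Complex.normSq_eq_norm_sq, Complex.normSq_apply]
    simp
    ring
  simp only [e] at h1
  have h2 := h1.mul_left 4
  constructor
  · exact h2.of_nonneg_of_le (fun n => sq_nonneg _) fun n => by nlinarith [sq_nonneg (sinCoeff f n)]
  · exact h2.of_nonneg_of_le (fun n => sq_nonneg _) fun n => by nlinarith [sq_nonneg (cosCoeff f n)]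

/-- |a k| is the product of |k a k| and 1/k, at most the sum of their squares; k = 0 is discarded.
-/
theorem summable_of_mul_sq_summable {a : ℕ → ℝ}
    (h : Summable fun k : ℕ => ((k : ℝ) * a k) ^ 2) : Summable a := by
  have h1 : Summable fun k : ℕ => (1 : ℝ) / (k : ℝ) ^ 2 := Real.summable_one_div_nat_pow.2 one_lt_two
  refine Summable.of_norm_bounded_eventually_nat (h.add h1) ?_
  filter_upwards [eventually_ge_atTop 1] with k hk
  have hk0 : (0 : ℝ) < k := by exact_mod_cast hk
  have h2 : |a k| = |k * a k| * (1 / k) := by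
    rw [abs_mul, abs_of_pos hk0]
    field_simp
  have h3 : (1 : ℝ) / (k : ℝ) ^ 2 = (1 / k) ^ 2 := by ring
  rw [Real.norm_eq_abs, h2, h3, ← sq_abs (k * a k)]
  nlinarith [sq_nonneg (|k * a k| - 1 / (k : ℝ)), abs_nonneg (k * a k)]

/-- The Fourier series of a periodic `C¹` function converges absolutely to the function. -/
theorem hasSum_fourier_of_hasDerivAt {f f' : ℝ → ℝ} (hf : ∀ x, HasDerivAt f (f' x) x)
    (hf' : Continuous f') (hp : Function.Periodic f (2 * Real.pi))
    (hp' : Function.Periodic f' (2 * Real.pi)) :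
    Summable (cosCoeff f) ∧ Summable (sinCoeff f) ∧ ∀ x : ℝ,
      HasSum (fun k : ℕ => cosCoeff f k * Real.cos (k * x) + sinCoeff f k * Real.sin (k * x))
        (f x + cosCoeff f 0 / 2) := by
  have hfc : Continuous f := continuous_iff_continuousAt.2 fun x => (hf x).continuousAt
  obtain ⟨s1, s2⟩ := summable_sq_fourierCoeffs hf' hp'
  have hc : Summable (cosCoeff f) := by
    refine summable_of_mul_sq_summable (s2.congr fun k => ?_)
    rw [sinCoeff_deriv hf hf' hp, neg_mul, neg_sq]
  have hs : Summable (sinCoeff f) := by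
    refine summable_of_mul_sq_summable (s1.congr fun k => ?_)
    rw [cosCoeff_deriv hf hf' hp]
  refine ⟨hc, hs, fun x => ?_⟩
  have : Fact (0 < 2 * Real.pi) := ⟨by positivity⟩
  have hpc : Function.Periodic (fun x => (f x : ℂ)) (2 * Real.pi) := fun x => by simp only [hp x]
  let F : C(AddCircle (2 * Real.pi), ℂ) :=
    ⟨hpc.lift, (by fun_prop : Continuous fun x => (f x : ℂ)).quotient_lift _⟩
  have hF : ∀ x : ℝ, F x = f x := fun x => rfl
  have hsum : Summable (fourierCoeff F) := by
    have b1 : Summable fun n : ℕ => fourierCoeff F (n : ℤ) := by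
      refine Summable.of_norm_bounded ((hc.abs.add hs.abs)) fun n => ?_
      rw [(fourierCoeff_eq hfc hF n).1, norm_div]
      have h1 := norm_sub_le (cosCoeff f n : ℂ) (sinCoeff f n * Complex.I)
      simp only [norm_mul, Complex.norm_real, Complex.norm_I, mul_one, Real.norm_eq_abs] at h1
      have : ‖(2 : ℂ)‖ = 2 := by simp
      rw [this]
      have := abs_nonneg (cosCoeff f n)
      have := abs_nonneg (sinCoeff f n)
      linarith
    have b2 : Summable fun n : ℕ => fourierCoeff F (-(n : ℤ)) := by
      refine Summable.of_norm_bounded ((hc.abs.add hs.abs)) fun n => ?_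
      rw [(fourierCoeff_eq hfc hF n).2, norm_div]
      have h1 := norm_add_le (cosCoeff f n : ℂ) (sinCoeff f n * Complex.I)
      simp only [norm_mul, Complex.norm_real, Complex.norm_I, mul_one, Real.norm_eq_abs] at h1
      have : ‖(2 : ℂ)‖ = 2 := by simp
      rw [this]
      have := abs_nonneg (cosCoeff f n)
      have := abs_nonneg (sinCoeff f n)
      linarith
    exact Summable.of_nat_of_neg b1 b2
  -- Pairing n with -n counts n = 0 twice, whence the extra `cosCoeff f 0 / 2` beside f x.
  have h := (has_pointwise_sum_fourier_series_of_summable hsum (x : AddCircle (2 * Real.pi))).nat_add_neg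
  have e : ∀ n : ℕ, fourierCoeff F (n : ℤ) • fourier (n : ℤ) (x : AddCircle (2 * Real.pi)) +
      fourierCoeff F (-(n : ℤ)) • fourier (-(n : ℤ)) (x : AddCircle (2 * Real.pi)) =
      ((cosCoeff f n * Real.cos (n * x) + sinCoeff f n * Real.sin (n * x) : ℝ) : ℂ) := by
    intro n
    have e1 : ∀ m : ℤ, fourier m (x : AddCircle (2 * Real.pi)) =
        (Real.cos (m * x) : ℂ) + Real.sin (m * x) * Complex.I := by
      intro m
      rw [fourier_coe_apply]
      have : 2 * (Real.pi : ℂ) * Complex.I * (m : ℂ) * x / ((2 * Real.pi : ℝ) : ℂ) =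
          ((m * x : ℝ) : ℂ) * Complex.I := by
        have : (Real.pi : ℂ) ≠ 0 := by exact_mod_cast Real.pi_ne_zero
        push_cast
        field_simp
      rw [this, Complex.exp_mul_I]
      push_cast
      ring
    rw [e1, e1, (fourierCoeff_eq hfc hF n).1, (fourierCoeff_eq hfc hF n).2]
    simp only [smul_eq_mul, Int.cast_neg, neg_mul, Real.cos_neg, Real.sin_neg, Int.cast_natCast]
    push_cast
    linear_combination (-(sinCoeff f n : ℂ) * Complex.sin (n * x)) * Complex.I_sq
  simp only [e] at h
  have e0 : F x + fourierCoeff F 0 • fourier 0 (x : AddCircle (2 * Real.pi)) =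
      ((f x + cosCoeff f 0 / 2 : ℝ) : ℂ) := by
    have h0 := (fourierCoeff_eq hfc hF 0).1
    have s0 : sinCoeff f 0 = 0 := by simp [sinCoeff]
    rw [s0] at h0
    simp only [Nat.cast_zero] at h0
    rw [h0, hF, fourier_zero]
    simp
  rw [e0] at h
  exact_mod_cast h

/-! ### The Hilbert transform as a Fourier multiplier. -/

theorem one_sub_cos_ne_zero {t : ℝ} (h0 : 0 < t) (ht : t ≤ Real.pi) : 1 - Real.cos t ≠ 0 := by
  have h := sq_div_five_le_one_sub_cos (t := t) (by rwa [abs_of_pos h0])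
  exact (lt_of_lt_of_le (by positivity) h).ne'

theorem sin_succ_mul_cotHalf {t : ℝ} (h0 : 0 < t) (ht : t ≤ Real.pi) (k : ℕ) :
    Real.sin ((k + 1 : ℕ) * t) * cotHalf t =
      Real.sin (k * t) * cotHalf t + (Real.cos ((k + 1 : ℕ) * t) + Real.cos (k * t)) := by
  have hne := one_sub_cos_ne_zero h0 ht
  have e : ((k + 1 : ℕ) : ℝ) * t = k * t + t := by push_cast; ring
  rw [e, Real.sin_add, Real.cos_add, cotHalf]
  field_simp
  have h2 : Real.sin t ^ 2 = 1 - Real.cos t ^ 2 := Real.sin_sq t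
  linear_combination Real.cos (k * t) * h2

theorem integral_cos_nat_mul {k : ℕ} (hk : k ≠ 0) : ∫ t in 0..Real.pi, Real.cos (k * t) = 0 := by
  have hk' : (k : ℝ) ≠ 0 := Nat.cast_ne_zero.2 hk
  rw [intervalIntegral.integral_comp_mul_left (fun t => Real.cos t) hk', integral_cos,
    Real.sin_nat_mul_pi]
  simp

/-- Passing from k to k + 1 adds two cosines to the integrand. They integrate to zero, except for
the constant 1 at the start, which gives π. -/
theorem integral_sin_mul_cotHalf (k : ℕ) :
    IntervalIntegrable (fun t => Real.sin ((k + 1 : ℕ) * t) * cotHalf t) MeasureTheory.volume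
      0 Real.pi ∧ ∫ t in 0..Real.pi, Real.sin ((k + 1 : ℕ) * t) * cotHalf t = Real.pi := by
  have step : ∀ k : ℕ, ∀ t ∈ Ioc 0 Real.pi, Real.sin ((k + 1 : ℕ) * t) * cotHalf t =
      Real.sin (k * t) * cotHalf t + (Real.cos ((k + 1 : ℕ) * t) + Real.cos (k * t)) :=
    fun k t ht => sin_succ_mul_cotHalf ht.1 ht.2 k
  have hci : ∀ k : ℕ, IntervalIntegrable (fun t => Real.cos (k * t)) MeasureTheory.volume
      0 Real.pi := fun k => Continuous.intervalIntegrable (by fun_prop) _ _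
  induction k with
  | zero =>
    have h1 : EqOn (fun t => Real.cos ((0 + 1 : ℕ) * t) + Real.cos ((0 : ℕ) * t))
        (fun t => Real.sin ((0 + 1 : ℕ) * t) * cotHalf t) (uIoc 0 Real.pi) := by
      intro t ht
      rw [uIoc_of_le Real.pi_pos.le] at ht
      have h := step 0 t ht
      simp only [Nat.cast_zero, zero_mul, Real.sin_zero, zero_add] at h ⊢
      exact h.symm
    refine ⟨((hci (0 + 1)).add (hci 0)).congr h1, ?_⟩
    rw [← intervalIntegral.integral_congr_ae (MeasureTheory.ae_of_all _ h1),
      intervalIntegral.integral_add (hci (0 + 1)) (hci 0), integral_cos_nat_mul (by lia)]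
    simp
  | succ k ih =>
    have h1 : EqOn (fun t => Real.sin ((k + 1 : ℕ) * t) * cotHalf t +
        (Real.cos ((k + 1 + 1 : ℕ) * t) + Real.cos ((k + 1 : ℕ) * t)))
        (fun t => Real.sin ((k + 1 + 1 : ℕ) * t) * cotHalf t) (uIoc 0 Real.pi) := by
      intro t ht
      rw [uIoc_of_le Real.pi_pos.le] at ht
      exact (step (k + 1) t ht).symm
    refine ⟨(ih.1.add ((hci _).add (hci _))).congr h1, ?_⟩
    rw [← intervalIntegral.integral_congr_ae (MeasureTheory.ae_of_all _ h1),
      intervalIntegral.integral_add ih.1 ((hci _).add (hci _)),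
      intervalIntegral.integral_add (hci _) (hci _), integral_cos_nat_mul (by lia),
      integral_cos_nat_mul (by lia), ih.2]
    simp

theorem integral_comp_sub_mul_eq {f e : ℝ → ℝ} (hpf : Function.Periodic f (2 * Real.pi))
    (hpe : Function.Periodic e (2 * Real.pi)) (t : ℝ) :
    ∫ x in -Real.pi..Real.pi, f (x - t) * e x = ∫ x in -Real.pi..Real.pi, f x * e (x + t) := by
  have hper : Function.Periodic (fun x => f x * e (x + t)) (2 * Real.pi) := fun x => by
    simp only [hpf x, show x + 2 * Real.pi + t = x + t + 2 * Real.pi by ring, hpe (x + t)]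
  have h := hper.intervalIntegral_add_eq (-Real.pi - t) (-Real.pi)
  rw [show -Real.pi - t + 2 * Real.pi = Real.pi - t by ring,
    show -Real.pi + 2 * Real.pi = Real.pi by ring] at h
  rw [← h, ← intervalIntegral.integral_comp_sub_right (fun x => f x * e (x + t)) t]
  simp only [sub_add_cancel]

namespace HolderBound

variable {α A : ℝ} {f : ℝ → ℝ}

open MeasureTheory in
/-- The Hilbert transform is skew-adjoint: its pairing with a test function, computed by Fubini. -/
theorem integral_hilbert_mul (hα0 : 0 < α) (hα1 : α < 1) (hf : HolderBound α 0 A f) {e : ℝ → ℝ}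
    (he : Continuous e) (hpe : Function.Periodic e (2 * Real.pi)) (hb : ∀ x, |e x| ≤ 1) :
    ∫ x in -Real.pi..Real.pi, hilbert f x * e x = 1 / (2 * Real.pi) * ∫ t in 0..Real.pi,
      cotHalf t * ∫ x in -Real.pi..Real.pi, f x * (e (x + t) - e (x - t)) := by
  have hc := hf.continuous hα0
  have h1 : ∀ x, hilbert f x * e x = 1 / (2 * Real.pi) *
      ∫ t in 0..Real.pi, (f (x - t) - f (x + t)) * cotHalf t * e x := fun x => by
    rw [hf.hilbert_eq hα0 hα1, mul_assoc, intervalIntegral.integral_mul_const]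
  simp only [h1, intervalIntegral.integral_const_mul]
  congr 1
  rw [intervalIntegral_intervalIntegral_swap]
  · refine intervalIntegral.integral_congr fun t _ => ?_
    have h2 : ∀ x, (f (x - t) - f (x + t)) * cotHalf t * e x =
        cotHalf t * (f (x - t) * e x - f (x - -t) * e x) := fun x => by
      rw [sub_neg_eq_add]; ring
    simp only [h2, intervalIntegral.integral_const_mul]
    rw [intervalIntegral.integral_sub (Continuous.intervalIntegrable (by fun_prop) _ _)
      (Continuous.intervalIntegrable (by fun_prop) _ _),
      integral_comp_sub_mul_eq hf.periodic hpe, integral_comp_sub_mul_eq hf.periodic hpe]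
    simp only [← sub_eq_add_neg, mul_sub]
    rw [intervalIntegral.integral_sub (Continuous.intervalIntegrable (by fun_prop) _ _)
      (Continuous.intervalIntegrable (by fun_prop) _ _), mul_sub]
  -- Fubini is legitimate because 10 A t^(α - 1), independent of x, dominates on the product.
  · rw [IntegrableOn, Measure.volume_eq_prod, ← Measure.prod_restrict]
    have hg : Integrable (fun t => 10 * A * t ^ (α - 1)) (volume.restrict (uIoc 0 Real.pi)) := by
      have := intervalIntegrable_const_mul_rpow hα0 (10 * A) (a := 0) (b := Real.pi)
      rwa [intervalIntegrable_iff] at this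
    have hfin : IsFiniteMeasure (volume.restrict (uIoc (-Real.pi) Real.pi)) := by
      rw [uIoc_of_le (by linarith [Real.pi_pos])]
      infer_instance
    refine (hg.comp_snd (volume.restrict (uIoc (-Real.pi) Real.pi))).mono' ?_ ?_
    · have m1 := hc.measurable
      have m2 := measurable_cotHalf
      have m3 := he.measurable
      exact Measurable.aestronglyMeasurable (by unfold Function.uncurry; fun_prop)
    · rw [Measure.prod_restrict]
      filter_upwards [ae_restrict_mem (measurableSet_uIoc.prod measurableSet_uIoc)] with p hp
      have hp2 := hp.2
      rw [uIoc_of_le Real.pi_pos.le] at hp2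
      rw [Function.uncurry_def, norm_mul]
      exact (mul_le_of_le_one_right (norm_nonneg _) (hb _)).trans
        (hf.abs_hilbertIntegrand_le hα1 p.1 hp2.1 hp2.2)

/-- The difference of shifted sines is 2 sin kt cos kx, so the double integral factors and the
t-integral is π. The shift k + 1 excludes frequency zero, where the mean of f would be lost. -/
theorem sinCoeff_hilbert (hα0 : 0 < α) (hα1 : α < 1) (hf : HolderBound α 0 A f) (k : ℕ) :
    sinCoeff (hilbert f) (k + 1) = cosCoeff f (k + 1) := by
  rw [sinCoeff, cosCoeff, hf.integral_hilbert_mul hα0 hα1 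
    (e := fun x => Real.sin ((k + 1 : ℕ) * x)) (by fun_prop)
    (sin_nat_mul_add_two_pi (k + 1)) fun x => Real.abs_sin_le_one _]
  have h : ∀ t, cotHalf t * ∫ x in -Real.pi..Real.pi,
      f x * (Real.sin ((k + 1 : ℕ) * (x + t)) - Real.sin ((k + 1 : ℕ) * (x - t))) =
      (2 * ∫ x in -Real.pi..Real.pi, f x * Real.cos ((k + 1 : ℕ) * x)) *
        (Real.sin ((k + 1 : ℕ) * t) * cotHalf t) := by
    intro t
    have h1 : ∀ x, f x * (Real.sin ((k + 1 : ℕ) * (x + t)) - Real.sin ((k + 1 : ℕ) * (x - t))) =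
        2 * Real.sin ((k + 1 : ℕ) * t) * (f x * Real.cos ((k + 1 : ℕ) * x)) := fun x => by
      rw [mul_add _ x t, mul_sub _ x t, Real.sin_add, Real.sin_sub]; ring
    simp only [h1, intervalIntegral.integral_const_mul]
    ring
  simp only [h, intervalIntegral.integral_const_mul, (integral_sin_mul_cotHalf k).2]
  field_simp

theorem cosCoeff_hilbert (hα0 : 0 < α) (hα1 : α < 1) (hf : HolderBound α 0 A f) (k : ℕ) :
    cosCoeff (hilbert f) k = -sinCoeff f k := by
  rw [sinCoeff, cosCoeff, hf.integral_hilbert_mul hα0 hα1 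
    (e := fun x => Real.cos (k * x)) (by fun_prop)
    (cos_nat_mul_add_two_pi k) fun x => Real.abs_cos_le_one _]
  have h : ∀ t, cotHalf t * ∫ x in -Real.pi..Real.pi,
      f x * (Real.cos (k * (x + t)) - Real.cos (k * (x - t))) =
      (-2 * ∫ x in -Real.pi..Real.pi, f x * Real.sin (k * x)) *
        (Real.sin (k * t) * cotHalf t) := by
    intro t
    have h1 : ∀ x, f x * (Real.cos (k * (x + t)) - Real.cos (k * (x - t))) =
        -2 * Real.sin (k * t) * (f x * Real.sin (k * x)) := fun x => by
      rw [mul_add _ x t, mul_sub _ x t, Real.cos_add, Real.cos_sub]; ring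
    simp only [h1, intervalIntegral.integral_const_mul]
    ring
  simp only [h, intervalIntegral.integral_const_mul]
  cases k with
  | zero => simp
  | succ k =>
    rw [(integral_sin_mul_cotHalf k).2]
    field_simp

end HolderBound

/-! ### Periodic primitives. -/

theorem hasDerivAt_primitive {w : ℝ → ℝ} (hw : Continuous w) (x : ℝ) :
    HasDerivAt (fun x => ∫ t in 0..x, w t) (w x) x :=
  intervalIntegral.integral_hasDerivAt_right (hw.intervalIntegrable _ _)
    hw.stronglyMeasurable.stronglyMeasurableAtFilter hw.continuousAt

theorem periodic_primitive {w : ℝ → ℝ} (hw : Continuous w)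
    (hp : Function.Periodic w (2 * Real.pi)) (h0 : cosCoeff w 0 = 0) :
    Function.Periodic (fun x => ∫ t in 0..x, w t) (2 * Real.pi) := by
  intro x
  have h1 : ∫ t in -Real.pi..Real.pi, w t = 0 := by
    simpa [cosCoeff, Real.pi_ne_zero] using h0
  have h2 := hp.intervalIntegral_add_eq x (-Real.pi)
  rw [show -Real.pi + 2 * Real.pi = Real.pi by ring, h1] at h2
  change ∫ t in 0..x + 2 * Real.pi, w t = ∫ t in 0..x, w t
  rw [← intervalIntegral.integral_add_adjacent_intervals (hw.intervalIntegrable 0 x)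
    (hw.intervalIntegrable x (x + 2 * Real.pi)), h2, add_zero]

theorem odd_primitive {w : ℝ → ℝ} (he : Function.Even w) :
    Function.Odd (fun x => ∫ t in 0..x, w t) := by
  intro x
  have h := intervalIntegral.integral_comp_neg (a := 0) (b := x) w
  simp only [he _, neg_zero] at h
  change ∫ t in 0..-x, w t = -∫ t in 0..x, w t
  rw [h, intervalIntegral.integral_symm]

theorem even_primitive {w : ℝ → ℝ} (ho : Function.Odd w) :
    Function.Even (fun x => ∫ t in 0..x, w t) := by
  intro x
  have h := intervalIntegral.integral_comp_neg (a := 0) (b := x) w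
  simp only [ho _, neg_zero, intervalIntegral.integral_neg] at h
  change ∫ t in 0..-x, w t = ∫ t in 0..x, w t
  rw [intervalIntegral.integral_symm, ← h, neg_neg]

namespace HolderBound

variable {α A : ℝ} {n : ℕ} {w : ℝ → ℝ}

theorem primitive (hα0 : 0 < α) (hw : HolderBound α n A w) (h0 : cosCoeff w 0 = 0) :
    HolderBound α (n + 1) (2 * Real.pi * A) (fun x => ∫ t in 0..x, w t) := by
  have hc := hw.continuous hα0
  have hp := periodic_primitive hc hw.periodic h0
  have hd : _root_.deriv (fun x => ∫ t in 0..x, w t) = w :=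
    funext fun x => (hasDerivAt_primitive hc x).deriv
  refine ⟨hp, fun x => (hasDerivAt_primitive hc x).differentiableAt, fun x => ?_, ?_⟩
  · obtain ⟨y, hy, hxy⟩ := hp.exists_mem_Ico₀ (by positivity) x
    change |∫ t in 0..x, w t| ≤ _
    rw [hxy]
    have h := intervalIntegral.norm_integral_le_of_norm_le_const (a := 0) (b := y) (f := w)
      (C := A) fun t _ => hw.abs_le t
    rw [sub_zero, abs_of_nonneg hy.1] at h
    exact h.trans (by nlinarith [hw.nonneg, hy.2])
  · rw [hd]
    refine hw.mono ?_
    nlinarith [hw.nonneg, Real.pi_gt_three]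

theorem const (α : ℝ) (n : ℕ) (c : ℝ) : HolderBound α n |c| (fun _ => c) := by
  have h : ∀ n : ℕ, HolderBound α n 0 (fun _ => (0 : ℝ)) := by
    intro n
    induction n with
    | zero => exact ⟨fun _ => rfl, by simp, by simp⟩
    | succ n ih => exact ⟨fun _ => rfl, by simp, by simp, by simpa using ih⟩
  cases n with
  | zero => exact ⟨fun _ => rfl, fun _ => le_rfl, fun x y => by simp; positivity⟩
  | succ n =>
    refine ⟨fun _ => rfl, by simp, fun _ => le_rfl, ?_⟩
    simpa using (h n).mono (abs_nonneg c)

/-- A mean-zero primitive of an odd function. -/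
theorem exists_even_primitive (hα0 : 0 < α) (hw : HolderBound α n A w) (ho : Function.Odd w) :
    ∃ W : ℝ → ℝ, HolderBound α (n + 1) (4 * Real.pi * A) W ∧ Function.Even W ∧
      cosCoeff W 0 = 0 ∧ ∀ k : ℕ, cosCoeff W (k + 1) = -sinCoeff w (k + 1) / (k + 1) := by
  have hc := hw.continuous hα0
  have h0 := cosCoeff_eq_zero_of_odd ho 0
  set W0 : ℝ → ℝ := fun x => ∫ t in 0..x, w t with hW0
  have hW := hw.primitive hα0 h0
  have hWc : Continuous W0 := hW.continuous hα0
  -- The zeroth coefficient of the constant 1 is 2, so the mean is half of `cosCoeff W0 0`.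
  set c : ℝ := -(cosCoeff W0 0 / 2) with hcdef
  have hcc : ∀ k, cosCoeff (fun x => W0 x + c) k = cosCoeff W0 k + c * cosCoeff (fun _ => 1) k := by
    intro k
    rw [cosCoeff_add hWc continuous_const, ← cosCoeff_const_mul]
    simp
  have hd : ∀ x, HasDerivAt (fun x => W0 x + c) (w x) x := fun x =>
    (hasDerivAt_primitive hc x).add_const c
  have hcabs : |c| ≤ 2 * Real.pi * A := by
    have := abs_cosCoeff_le hW.abs_le 0
    rw [hcdef, abs_neg, abs_div, abs_two]
    linarith
  have hB := (hW.add (const α (n + 1) c)).mono (B := 4 * Real.pi * A) (by linarith)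
  refine ⟨fun x => W0 x + c, hB, fun x => ?_, ?_, fun k => ?_⟩
  · exact congrArg (· + c) (even_primitive ho x)
  · have h1 : cosCoeff (fun _ => 1) 0 = 2 := by
      simp [cosCoeff]
      field_simp
      norm_num
    rw [hcc, h1, hcdef]
    ring
  · rw [sinCoeff_deriv hd hc hB.periodic]
    push_cast
    field_simp

end HolderBound

/-! ### Elementary multipliers bounded on Hölder spaces. -/

section operators

variable {α : ℝ}

/-- The Fourier multiplier `1 / k` on odd functions. -/
theorem exists_antiderivative_hilbert (hα0 : 0 < α) (hα1 : α < 1) :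
    ∃ C, 0 ≤ C ∧ ∀ (n : ℕ) (A : ℝ) (g : ℝ → ℝ), HolderBound α n A g → Function.Odd g →
      ∃ v : ℝ → ℝ, HolderBound α (n + 1) (C * A) v ∧ Function.Odd v ∧
        ∀ k : ℕ, sinCoeff v (k + 1) = sinCoeff g (k + 1) / (k + 1) := by
  obtain ⟨C, hC, hH⟩ := exists_holderBound_hilbert hα0 hα1
  refine ⟨2 * Real.pi * C, by positivity, fun n A g hg ho => ?_⟩
  have hg0 := hg.of_le hα0 hα1 (Nat.zero_le n)
  -- -Hg turns the sine coefficients of g into cosine coefficients and has mean zero; its primitive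
  -- is again a sine series, with coefficients divided by k.
  have h1 := (hH n A g hg).const_mul (-1)
  rw [abs_neg, abs_one, one_mul] at h1
  have hcoef : ∀ k, cosCoeff (fun x => -1 * hilbert g x) k = sinCoeff g k := fun k => by
    rw [cosCoeff_const_mul, hg0.cosCoeff_hilbert hα0 hα1]
    ring
  have h0 : cosCoeff (fun x => -1 * hilbert g x) 0 = 0 := by
    rw [hcoef]
    simp [sinCoeff]
  have hp := h1.primitive hα0 h0
  refine ⟨_, hp.mono (le_of_eq (by ring)), odd_primitive fun x => ?_, fun k => ?_⟩
  · rw [hg0.even_hilbert hα0 hα1 ho x]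
  · rw [← hcoef, cosCoeff_deriv (hasDerivAt_primitive (h1.continuous hα0)) (h1.continuous hα0)
      hp.periodic]
    push_cast
    field_simp

/-- The inverse of `h ↦ hilbert h''` on odd functions. -/
theorem exists_inverse_hilbert_deriv_deriv (hα0 : 0 < α) (hα1 : α < 1) :
    ∃ C, 0 ≤ C ∧ ∀ (A : ℝ) (u : ℝ → ℝ), HolderBound α 1 A u → Function.Odd u →
      ∃ h : ℝ → ℝ, HolderBound α 3 (C * A) h ∧ Function.Even h ∧ cosCoeff h 0 = 0 ∧
        ∀ k : ℕ, cosCoeff h (k + 1) = -sinCoeff u (k + 1) / (k + 1) ^ 2 := by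
  obtain ⟨C, hC, hV⟩ := exists_antiderivative_hilbert hα0 hα1
  refine ⟨4 * Real.pi * C, by positivity, fun A u hu ho => ?_⟩
  obtain ⟨v, hv, hvo, hvk⟩ := hV 1 A u hu ho
  obtain ⟨h, hh, he, h0, hk⟩ := hv.exists_even_primitive hα0 hvo
  refine ⟨h, hh.mono (le_of_eq (by ring)), he, h0, fun k => ?_⟩
  rw [hk, hvk]
  field_simp

/-- A sine series with coefficients of order `k⁻⁴`. -/
theorem exists_holderBound_sine_series (hα0 : 0 < α) (hα1 : α < 1) :
    ∃ C, 0 ≤ C ∧ ∀ (D : ℝ) (d : ℕ → ℝ), (∀ k, |d k| ≤ D / (k + 1 : ℝ) ^ 4) →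
      ∃ f : ℝ → ℝ, HolderBound α 1 (C * D) f ∧ Function.Odd f ∧
        ∀ k : ℕ, sinCoeff f (k + 1) = d k := by
  have hS : Summable fun k : ℕ => 1 / ((k : ℝ) + 1) ^ 2 := by
    have := (summable_nat_add_iff 1).2 (Real.summable_one_div_nat_pow.2 one_lt_two)
    simpa using this
  set S := ∑' k : ℕ, 1 / ((k : ℝ) + 1) ^ 2 with hSdef
  have hS0 : 0 ≤ S := tsum_nonneg fun k => by positivity
  refine ⟨2 * S, by positivity, fun D d hd => ?_⟩
  have hD : 0 ≤ D := by
    have := (abs_nonneg _).trans (hd 0)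
    simpa using this
  have hk1 : ∀ k : ℕ, (1 : ℝ) ≤ (k : ℝ) + 1 := fun k => by linarith [(Nat.cast_nonneg k : (0 : ℝ) ≤ k)]
  have b2 : ∀ k : ℕ, |d k| * ((k : ℝ) + 1) ^ 2 ≤ D * (1 / ((k : ℝ) + 1) ^ 2) := fun k => by
    have hpos : (0 : ℝ) < (k : ℝ) + 1 := by linarith [hk1 k]
    calc _ ≤ D / ((k : ℝ) + 1) ^ 4 * ((k : ℝ) + 1) ^ 2 := by gcongr; exact hd k
      _ = _ := by field_simp
  have b1 : ∀ k : ℕ, |d k| * ((k : ℝ) + 1) ≤ D * (1 / ((k : ℝ) + 1) ^ 2) := fun k => by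
    refine le_trans ?_ (b2 k)
    gcongr
    exact le_self_pow₀ (hk1 k) two_ne_zero
  have b0 : ∀ k : ℕ, |d k| ≤ D * (1 / ((k : ℝ) + 1) ^ 2) := fun k =>
    (le_mul_of_one_le_right (abs_nonneg _) (hk1 k)).trans (b1 k)
  have hSD : Summable fun k : ℕ => D * (1 / ((k : ℝ) + 1) ^ 2) := hS.mul_left D
  have hsd : ∑' k : ℕ, D * (1 / ((k : ℝ) + 1) ^ 2) = S * D := by rw [tsum_mul_left, mul_comm]
  set f0 : ℕ → ℝ → ℝ := fun k x => d k * Real.sin ((k + 1) * x) with hf0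
  set f1 : ℕ → ℝ → ℝ := fun k x => d k * ((k + 1) * Real.cos ((k + 1) * x)) with hf1
  set f2 : ℕ → ℝ → ℝ := fun k x => d k * ((k + 1) * (-(k + 1) * Real.sin ((k + 1) * x))) with hf2
  have n0 : ∀ k x, ‖f0 k x‖ ≤ D * (1 / ((k : ℝ) + 1) ^ 2) := fun k x => by
    refine le_trans ?_ (b0 k)
    rw [hf0, norm_mul]
    exact mul_le_of_le_one_right (abs_nonneg _) (Real.abs_sin_le_one _)
  have n1 : ∀ k x, ‖f1 k x‖ ≤ D * (1 / ((k : ℝ) + 1) ^ 2) := fun k x => by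
    refine le_trans ?_ (b1 k)
    rw [hf1, norm_mul, norm_mul, Real.norm_of_nonneg (zero_le_one.trans (hk1 k))]
    refine mul_le_mul_of_nonneg_left ?_ (abs_nonneg _)
    exact mul_le_of_le_one_right (zero_le_one.trans (hk1 k)) (Real.abs_cos_le_one _)
  have n2 : ∀ k x, ‖f2 k x‖ ≤ D * (1 / ((k : ℝ) + 1) ^ 2) := fun k x => by
    refine le_trans ?_ (b2 k)
    rw [hf2, norm_mul, norm_mul, norm_mul, norm_neg, Real.norm_of_nonneg (zero_le_one.trans (hk1 k)),
      sq]
    refine mul_le_mul_of_nonneg_left ?_ (abs_nonneg _)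
    refine mul_le_mul_of_nonneg_left ?_ (zero_le_one.trans (hk1 k))
    exact mul_le_of_le_one_right (zero_le_one.trans (hk1 k)) (Real.abs_sin_le_one _)
  have d0 : ∀ k x, HasDerivAt (f0 k) (f1 k x) x := fun k x =>
    (hasDerivAt_sin_mul _ x).const_mul _
  have d1 : ∀ k x, HasDerivAt (f1 k) (f2 k x) x := fun k x =>
    ((hasDerivAt_cos_mul _ x).const_mul _).const_mul _
  have s0 : ∀ x, Summable fun k => f0 k x := fun x => Summable.of_norm_bounded hSD fun k => n0 k x
  have s1 : ∀ x, Summable fun k => f1 k x := fun x => Summable.of_norm_bounded hSD fun k => n1 k x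
  have D0 : ∀ x, HasDerivAt (fun x => ∑' k, f0 k x) (∑' k, f1 k x) x := fun x =>
    hasDerivAt_tsum hSD d0 n1 (s0 0) x
  have D1 : ∀ x, HasDerivAt (fun x => ∑' k, f1 k x) (∑' k, f2 k x) x := fun x =>
    hasDerivAt_tsum hSD d1 n2 (s1 0) x
  have t0 : ∀ x, |∑' k, f0 k x| ≤ S * D := fun x =>
    hsd ▸ tsum_of_norm_bounded hSD.hasSum fun k => n0 k x
  have t1 : ∀ x, |∑' k, f1 k x| ≤ S * D := fun x =>
    hsd ▸ tsum_of_norm_bounded hSD.hasSum fun k => n1 k x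
  have t2 : ∀ x, |∑' k, f2 k x| ≤ S * D := fun x =>
    hsd ▸ tsum_of_norm_bounded hSD.hasSum fun k => n2 k x
  have hp0 : Function.Periodic (fun x => ∑' k, f0 k x) (2 * Real.pi) := fun x => by
    refine tsum_congr fun k => ?_
    have := sin_nat_mul_add_two_pi (k + 1) x
    push_cast at this
    rw [hf0]
    simp only [this]
  have hderiv : deriv (fun x => ∑' k, f0 k x) = fun x => ∑' k, f1 k x :=
    funext fun x => (D0 x).deriv
  refine ⟨fun x => ∑' k, f0 k x, ⟨hp0, fun x => (D0 x).differentiableAt,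
    fun x => (t0 x).trans (by nlinarith [mul_nonneg hS0 hD]), ?_⟩, fun x => ?_, fun k => ?_⟩
  · have hp1 := periodic_deriv hp0
    rw [hderiv] at hp1 ⊢
    refine (HolderBound.of_lipschitz hα0 hα1 hp1 t1 fun x y => ?_).mono (le_of_eq (by ring))
    exact Convex.norm_image_sub_le_of_norm_hasDerivWithin_le (s := univ)
      (fun z _ => (D1 z).hasDerivWithinAt) (fun z _ => t2 z) convex_univ (mem_univ y) (mem_univ x)
  · simp only [hf0, mul_neg, Real.sin_neg, tsum_neg]
  · have hsum : Summable d := Summable.of_norm_bounded hSD b0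
    exact sinCoeff_succ_of_hasSum hsum (fun x => (s0 x).hasSum) k

end operators

/-! ### The quadratic symbol and its parametrix. -/

section multiplier

/-- The symbol `Q k² + E k - R` at the frequency `k + 1`. -/
def quadSymbol (Q E R : ℝ) (k : ℕ) : ℝ := Q * (k + 1) ^ 2 + E * (k + 1) - R

variable {Q : ℝ}

theorem eventually_le_abs_quadSymbol (hQ : Q ≠ 0) (E R : ℝ) :
    ∀ᶠ k : ℕ in atTop, |Q| / 2 * (k + 1 : ℝ) ^ 2 ≤ |quadSymbol Q E R k| := by
  have hQ' : 0 < |Q| := abs_pos.2 hQ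
  filter_upwards [eventually_ge_atTop ⌈2 * (|E| + |R|) / |Q|⌉₊] with k hk
  have hk1 : 2 * (|E| + |R|) / |Q| ≤ k := (Nat.le_ceil _).trans (by exact_mod_cast hk)
  rw [div_le_iff₀ hQ'] at hk1
  have hk0 : (0 : ℝ) ≤ k := Nat.cast_nonneg k
  have h1 : |Q| * (k + 1 : ℝ) ^ 2 - |E| * (k + 1) - |R| ≤ |quadSymbol Q E R k| := by
    have e : Q * (k + 1 : ℝ) ^ 2 = quadSymbol Q E R k - E * (k + 1) + R := by
      rw [quadSymbol]; ring
    have h2 : |Q| * (k + 1 : ℝ) ^ 2 = |Q * (k + 1 : ℝ) ^ 2| := by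
      rw [abs_mul, abs_of_nonneg (by positivity : (0 : ℝ) ≤ (k + 1 : ℝ) ^ 2)]
    have h3 : |E * (k + 1 : ℝ)| = |E| * (k + 1) := by
      rw [abs_mul, abs_of_nonneg (by positivity : (0 : ℝ) ≤ (k + 1 : ℝ))]
    rw [h2, e]
    have h4 := abs_add_le (quadSymbol Q E R k - E * (k + 1)) R
    have h5 := abs_sub (quadSymbol Q E R k) (E * (k + 1))
    linarith
  nlinarith [abs_nonneg E, abs_nonneg R]

theorem finite_quadSymbol_zeros (hQ : Q ≠ 0) (E R : ℝ) : {k | quadSymbol Q E R k = 0}.Finite := by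
  obtain ⟨N, hN⟩ := eventually_atTop.1 (eventually_le_abs_quadSymbol hQ E R)
  refine (finite_lt_nat N).subset fun k hk => ?_
  by_contra h
  have h1 := hN k (not_lt.1 h)
  rw [mem_ofPred_eq] at hk
  rw [hk, abs_zero] at h1
  have : 0 < |Q| := abs_pos.2 hQ
  have : 0 < |Q| / 2 * (k + 1 : ℝ) ^ 2 := by positivity
  linarith

/-- Third-order expansion of `k² / (Q k² + E k - R)` in powers of `k⁻¹`, with bounded remainder
(and with the value `0` of the quotient at the zeros of the denominator). -/
theorem exists_quadSymbol_expansion (hQ : Q ≠ 0) (E R : ℝ) :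
    ∃ (c₁ c₂ M : ℝ) (w : ℕ → ℝ), (∀ k, |w k| ≤ M) ∧ ∀ k : ℕ,
      (k + 1 : ℝ) ^ 2 * (quadSymbol Q E R k)⁻¹ =
        1 / Q + c₁ / (k + 1) + c₂ / (k + 1) ^ 2 + w k / (k + 1) ^ 3 := by
  -- With n = k + 1, the quotient μ satisfies μ = 1/Q + bμ/n + dμ/n²; iterating this relation
  -- produces the coefficients b/Q and (b² + d)/Q.
  set b := -E / Q
  set d := R / Q
  set w : ℕ → ℝ := fun k => (k + 1 : ℝ) ^ 3 * ((k + 1 : ℝ) ^ 2 * (quadSymbol Q E R k)⁻¹ -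
    (1 / Q + b / Q / (k + 1) + (b ^ 2 + d) / Q / (k + 1) ^ 2)) with hw
  -- Boundedness for large k suffices, so the zeros of the symbol, where the inverse is 0 by
  -- convention, need no separate treatment.
  have hbd : BddAbove (range fun k => |w k|) := by
    refine IsBoundedUnder.bddAbove_range ?_
    have hQ' : 0 < |Q| := abs_pos.2 hQ
    refine isBoundedUnder_of_eventually_le
      (a := |b ^ 2 + d| * (|b| + |d|) * (2 / |Q|) + |b * d| * (2 / |Q|)) ?_
    filter_upwards [eventually_le_abs_quadSymbol hQ E R] with k hk
    have hpos : (0 : ℝ) < k + 1 := by positivity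
    have hq0 : quadSymbol Q E R k ≠ 0 := by
      have : 0 < |Q| / 2 * (k + 1 : ℝ) ^ 2 := by positivity
      exact abs_pos.1 (this.trans_le hk)
    set μ := (k + 1 : ℝ) ^ 2 * (quadSymbol Q E R k)⁻¹ with hμ
    have hμb : |μ| ≤ 2 / |Q| := by
      rw [hμ, abs_mul, abs_inv, abs_of_pos (by positivity : (0 : ℝ) < (k + 1 : ℝ) ^ 2),
        ← div_eq_mul_inv, div_le_div_iff₀ (abs_pos.2 hq0) hQ']
      linarith
    have e : w k = (b ^ 2 + d) * (b + d / (k + 1)) * μ + b * d * μ := by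
      have e1 : μ = 1 / Q + b * μ / (k + 1) + d * μ / (k + 1) ^ 2 := by
        have h2 : (k + 1 : ℝ) ^ 2 = μ * quadSymbol Q E R k := by
          rw [hμ]; field_simp
        have h3 : (k + 1 : ℝ) ^ 2 = μ * (Q * (k + 1) ^ 2 + E * (k + 1) - R) := h2
        simp only [b, d]
        field_simp
        linear_combination -h3
      have hwk : w k = (k + 1 : ℝ) ^ 3 *
          (μ - (1 / Q + b / Q / (k + 1) + (b ^ 2 + d) / Q / (k + 1) ^ 2)) := rfl
      have e2 : 1 / Q = μ - b * μ / (k + 1) - d * μ / (k + 1) ^ 2 := by linarith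
      have e3 : b / Q = b * (1 / Q) := by ring
      have e4 : (b ^ 2 + d) / Q = (b ^ 2 + d) * (1 / Q) := by ring
      rw [hwk, e3, e4, e2]
      field_simp
      ring
    rw [e]
    have hd1 : |d / (k + 1 : ℝ)| ≤ |d| := by
      rw [abs_div, abs_of_pos hpos]
      exact div_le_self (abs_nonneg _) (by linarith [(Nat.cast_nonneg k : (0 : ℝ) ≤ k)])
    refine (abs_add_le _ _).trans ?_
    rw [abs_mul, abs_mul, abs_mul (b * d)]
    gcongr
    exact (abs_add_le _ _).trans (by linarith)
  obtain ⟨M, hM⟩ := hbd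
  refine ⟨b / Q, (b ^ 2 + d) / Q, M, w, fun k => hM ⟨k, rfl⟩, fun k => ?_⟩
  rw [hw]
  field_simp
  ring

end multiplier

/-- The multiplier with symbol `-(Q k² + E k - R)⁻¹`, set to zero at the zeros of the denominator,
maps odd `C^{1,α}` functions to even mean-zero `C^{3,α}` functions. -/
theorem exists_parametrix {α : ℝ} (hα0 : 0 < α) (hα1 : α < 1) {Q : ℝ} (hQ : Q ≠ 0) (E R : ℝ) :
    ∃ C, 0 ≤ C ∧ ∀ (A : ℝ) (g : ℝ → ℝ), HolderBound α 1 A g → Function.Odd g →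
      ∃ h : ℝ → ℝ, HolderBound α 3 (C * A) h ∧ Function.Even h ∧ cosCoeff h 0 = 0 ∧
        ∀ k : ℕ, cosCoeff h (k + 1) = -(quadSymbol Q E R k)⁻¹ * sinCoeff g (k + 1) := by
  obtain ⟨CV, hCV, hV⟩ := exists_antiderivative_hilbert hα0 hα1
  obtain ⟨CS, hCS, hS⟩ := exists_inverse_hilbert_deriv_deriv hα0 hα1
  obtain ⟨CW, hCW, hW⟩ := exists_holderBound_sine_series hα0 hα1
  obtain ⟨c₁, c₂, M, w, hwM, hw⟩ := exists_quadSymbol_expansion hQ E R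
  have hM : 0 ≤ M := (abs_nonneg _).trans (hwM 0)
  set K := |1 / Q| + |c₁| * (2 * CV) + |c₂| * (2 * CV * (2 * CV)) + CW * (M * 2)
  refine ⟨CS * K, by positivity, fun A g hg ho => ?_⟩
  obtain ⟨v₁, hv₁, ho₁, hk₁⟩ := hV 1 A g hg ho
  have hv₁' := hv₁.of_succ hα0 hα1
  obtain ⟨v₂, hv₂, ho₂, hk₂⟩ := hV 1 _ v₁ hv₁' ho₁
  have hv₂' := hv₂.of_succ hα0 hα1
  -- As g is C¹, the coefficients of g' are at most 2A, so those of g are at most 2A/k; with |w| ≤ M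
  -- and k⁻³ this gives the required k⁻⁴.
  obtain ⟨v₃, hv₃, ho₃, hk₃⟩ := hW (M * (2 * A))
    (fun k => w k * sinCoeff g (k + 1) / (k + 1) ^ 3) fun k => by
      have h1 := abs_cosCoeff_le hg.deriv.abs_le (k + 1)
      rw [cosCoeff_deriv (fun x => (hg.differentiable x).hasDerivAt) (hg.deriv.continuous hα0)
        hg.periodic, abs_mul, abs_of_pos (by positivity)] at h1
      push_cast at h1
      rw [abs_div, abs_mul, abs_of_pos (by positivity : (0 : ℝ) < ((k : ℝ) + 1) ^ 3),
        div_le_div_iff₀ (by positivity) (by positivity)]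
      calc _ = |w k| * ((k + 1) * |sinCoeff g (k + 1)|) * (k + 1) ^ 3 := by ring
        _ ≤ M * (2 * A) * (k + 1) ^ 3 := by
          gcongr
          exact hwM k
  have c0 := hg.continuous hα0
  have c1 := hv₁.continuous hα0
  have c2 := hv₂.continuous hα0
  have c3 := hv₃.continuous hα0
  -- This sum is g multiplied by k² over the symbol; `hS` then supplies the factor -k⁻² and the two
  -- extra derivatives.
  have hu := (((hg.const_mul (1 / Q)).add (hv₁'.const_mul c₁)).add (hv₂'.const_mul c₂)).add hv₃
  obtain ⟨h, hh, he, h0, hk⟩ := hS _ _ hu fun x => by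
    rw [ho x, ho₁ x, ho₂ x, ho₃ x]; ring
  refine ⟨h, hh.mono (le_of_eq ?_), he, h0, fun k => ?_⟩
  · simp only [K]
    ring
  · rw [hk, sinCoeff_add (by fun_prop) c3, sinCoeff_add (by fun_prop) (by fun_prop),
      sinCoeff_add (by fun_prop) (by fun_prop), sinCoeff_const_mul, sinCoeff_const_mul,
      sinCoeff_const_mul, hk₂, hk₁, hk₃]
    have h1 := hw k
    have hpos : (0 : ℝ) < (k : ℝ) + 1 := by positivity
    have e : 1 / Q * sinCoeff g (k + 1) + c₁ * (sinCoeff g (k + 1) / (k + 1)) +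
        c₂ * (sinCoeff g (k + 1) / (k + 1) / (k + 1)) + w k * sinCoeff g (k + 1) / (k + 1) ^ 3 =
        ((k + 1 : ℝ) ^ 2 * (quadSymbol Q E R k)⁻¹) * sinCoeff g (k + 1) := by
      rw [h1]
      field_simp
    rw [e]
    field_simp

/-! ### Diagonal operators and their Fredholm index. -/

section diagonal

variable {X Y : Type*} [NormedAddCommGroup X] [NormedSpace ℝ X] [NormedAddCommGroup Y]
  [NormedSpace ℝ Y]

/-- A bounded operator prescribed by its action on coefficients. -/
theorem exists_clm_of_coeff {a : X →ₗ[ℝ] (ℕ → ℝ)} {b : Y →ₗ[ℝ] (ℕ → ℝ)}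
    (hb : Function.Injective b) (m : ℕ → ℝ) (K : ℝ) (P : X → Y → Prop)
    (h : ∀ x, ∃ y, P x y ∧ (∀ k, b y k = m k * a x k) ∧ ‖y‖ ≤ K * ‖x‖) :
    ∃ T : X →L[ℝ] Y, ∀ x, P x (T x) ∧ ∀ k, b (T x) k = m k * a x k := by
  choose t ht1 ht2 ht3 using h
  -- The chosen images depend linearly on x because the coefficients determine them. The predicate P
  -- carries along a concrete description of the image.
  let T : X →ₗ[ℝ] Y :=
    { toFun := t
      map_add' := fun x y => hb (funext fun k => by
        rw [map_add, Pi.add_apply, ht2, ht2, ht2, map_add, Pi.add_apply, mul_add])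
      map_smul' := fun c x => hb (funext fun k => by
        rw [map_smul, RingHom.id_apply, Pi.smul_apply, ht2, ht2, map_smul, Pi.smul_apply,
          smul_eq_mul, smul_eq_mul, mul_left_comm]) }
  exact ⟨T.mkContinuous K ht3, fun x => ⟨ht1 x, ht2 x⟩⟩

/-- Finitely many coefficients can be prescribed, the others being zero. -/
theorem exists_prescribed_coeff {W : Type*} [AddCommGroup W] [Module ℝ W] (w : W →ₗ[ℝ] (ℕ → ℝ))
    (hw : ∀ k, ∃ x, w x = Pi.single k 1) (Z : Set ℕ) [Fintype Z] (c : Z → ℝ) :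
    ∃ x, (∀ k : Z, w x k = c k) ∧ ∀ k, k ∉ Z → w x k = 0 := by
  choose e he using hw
  refine ⟨∑ j : Z, c j • e j, fun i => ?_, fun k hk => ?_⟩
  · rw [map_sum, Finset.sum_apply, Finset.sum_eq_single i]
    · simp [he]
    · intro j _ hj
      have : (i : ℕ) ≠ j := fun h => hj (Subtype.ext h.symm)
      simp [he, this]
    · simp
  · rw [map_sum, Finset.sum_apply]
    refine Finset.sum_eq_zero fun j _ => ?_
    have : k ≠ j := fun h => hk (h ▸ j.2)
    simp [he, this]

open LinearMap in
/-- An operator acting diagonally on coefficients, with finitely many zeros in its symbol and a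
bounded inverse off those zeros, is Fredholm of index zero. -/
theorem isFredholm_of_diagonal {a : X →ₗ[ℝ] (ℕ → ℝ)} {b : Y →ₗ[ℝ] (ℕ → ℝ)}
    (ha : Function.Injective a) (hb : Function.Injective b)
    (ha' : ∀ k, ∃ x, a x = Pi.single k 1) (hb' : ∀ k, ∃ y, b y = Pi.single k 1)
    {m : ℕ → ℝ} (hm : {k | m k = 0}.Finite) (T : X →L[ℝ] Y) (v : Y →L[ℝ] X)
    (hT : ∀ x k, b (T x) k = m k * a x k) (hv : ∀ y k, a (v y) k = (m k)⁻¹ * b y k) :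
    T.IsFredholm ∧ (T : X →ₗ[ℝ] Y).index = 0 := by
  set Z : Set ℕ := {k | m k = 0} with hZ
  have : Finite Z := hm
  have : Fintype Z := Fintype.ofFinite Z
  let res : (ℕ → ℝ) →ₗ[ℝ] (Z → ℝ) := LinearMap.funLeft ℝ ℝ ((↑) : Z → ℕ)
  have hres : ∀ f (k : Z), res f k = f k := fun f k => rfl
  -- v inverts T on the vectors without coefficients in Z, a subspace of finite codimension, so v is
  -- an inverse modulo finite rank.
  have hvT : ∀ x, res (a x) = 0 → v (T x) = x := fun x hx => ha (funext fun k => by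
    rw [hv, hT, ← mul_assoc]
    by_cases hk : m k = 0
    · have h0 : a x k = 0 := congrFun hx (⟨k, hk⟩ : Z)
      rw [h0, mul_zero]
    · rw [inv_mul_cancel₀ hk, one_mul])
  have hTv : ∀ y, res (b y) = 0 → T (v y) = y := fun y hy => hb (funext fun k => by
    rw [hT, hv, ← mul_assoc]
    by_cases hk : m k = 0
    · have h0 : b y k = 0 := congrFun hy (⟨k, hk⟩ : Z)
      rw [h0, mul_zero]
    · rw [mul_inv_cancel₀ hk, one_mul])
  refine ⟨.of_isQuasiInverse (v := v) ⟨?_, ?_⟩, ?_⟩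
  · exact LinearMap.FiniteRangeSetoid.equiv_of_eqOn_coFG (A := ker (res ∘ₗ a))
      (LinearMap.ker_coFG_iff_hasFiniteRange.2 .of_isNoetherian_rng) fun x hx => hvT x hx
  · exact LinearMap.FiniteRangeSetoid.equiv_of_eqOn_coFG (A := ker (res ∘ₗ b))
      (LinearMap.ker_coFG_iff_hasFiniteRange.2 .of_isNoetherian_rng) fun y hy => hTv y hy
  · rw [index_eq_finrank_sub]
    -- Reading coefficients on Z is injective on the kernel, since there v (T x) = 0, and surjective
    -- since vectors supported on Z are killed by T.
    have h1 : Module.finrank ℝ (ker (T : X →ₗ[ℝ] Y)) = Module.finrank ℝ (Z → ℝ) := by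
      refine (LinearEquiv.ofBijective ((res ∘ₗ a) ∘ₗ (ker (T : X →ₗ[ℝ] Y)).subtype)
        ⟨?_, fun c => ?_⟩).finrank_eq
      · rw [← LinearMap.ker_eq_bot, LinearMap.ker_eq_bot']
        rintro ⟨x, hx⟩ h0
        have h2 := hvT x h0
        have hx' : T x = 0 := hx
        rw [hx', map_zero] at h2
        exact Subtype.ext h2.symm
      · obtain ⟨x, hx, hx0⟩ := exists_prescribed_coeff a ha' Z c
        refine ⟨⟨x, ?_⟩, funext hx⟩
        refine LinearMap.mem_ker.2 (hb (funext fun k => ?_))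
        change b (T x) k = b 0 k
        rw [hT, map_zero, Pi.zero_apply]
        by_cases hk : m k = 0
        · rw [hk, zero_mul]
        · rw [hx0 k hk, mul_zero]
    have h2 : LinearMap.range (T : X →ₗ[ℝ] Y) = ker (res ∘ₗ b) := by
      ext y
      constructor
      · rintro ⟨x, rfl⟩
        refine LinearMap.mem_ker.2 (funext fun k => ?_)
        change b (T x) k = 0
        rw [hT, show m k = 0 from k.2, zero_mul]
      · exact fun hy => ⟨v y, hTv y hy⟩
    have h3 : Module.finrank ℝ (Y ⧸ LinearMap.range (T : X →ₗ[ℝ] Y)) = Module.finrank ℝ (Z → ℝ) := by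
      rw [h2]
      refine ((res ∘ₗ b).quotKerEquivOfSurjective fun c => ?_).finrank_eq
      obtain ⟨y, hy, -⟩ := exists_prescribed_coeff b hb' Z c
      exact ⟨y, funext hy⟩
    rw [h1, h3, sub_self]

end diagonal

/-! ### X and Y in terms of parity and coefficients. -/

section spaces

variable {α : ℝ≥0}

theorem hasSum_nat_succ {F : ℕ → ℝ} {s : ℝ} (h : HasSum F s) :
    HasSum (fun k => F (k + 1)) (s - F 0) := by
  have := (hasSum_nat_add_iff' 1).2 h
  simpa using this

theorem even_of_mem_spaceX {f : HolderTorus 3 α} (hf : f ∈ spaceX α) : Function.Even f := by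
  obtain ⟨a, -, h⟩ := hf
  intro x
  refine (h (-x)).unique ?_
  simpa only [mul_neg, Real.cos_neg] using h x

theorem odd_of_mem_spaceY {f : HolderTorus 1 α} (hf : f ∈ spaceY α) : Function.Odd f := by
  obtain ⟨a, -, h⟩ := hf
  intro x
  refine (h (-x)).unique ?_
  simpa only [mul_neg, Real.sin_neg] using (h x).neg

theorem HolderBound.hasSum_cos {A : ℝ} {n : ℕ} {f : ℝ → ℝ} (hα0 : 0 < α)
    (hf : HolderBound α (n + 1) A f) (he : Function.Even f) (h0 : cosCoeff f 0 = 0) :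
    Summable (fun k => cosCoeff f (k + 1)) ∧ ∀ x : ℝ,
      HasSum (fun k : ℕ => cosCoeff f (k + 1) * Real.cos ((k + 1) * x)) (f x) := by
  obtain ⟨h1, -, h2⟩ := hasSum_fourier_of_hasDerivAt
    (fun x => (hf.differentiable x).hasDerivAt) (hf.deriv.continuous (by exact_mod_cast hα0))
    hf.periodic hf.deriv.periodic
  refine ⟨(summable_nat_add_iff 1).2 h1, fun x => ?_⟩
  have h := hasSum_nat_succ (h2 x)
  simpa [sinCoeff_eq_zero_of_even he, h0] using h

theorem HolderBound.hasSum_sin {A : ℝ} {n : ℕ} {f : ℝ → ℝ} (hα0 : 0 < α)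
    (hf : HolderBound α (n + 1) A f) (ho : Function.Odd f) :
    Summable (fun k => sinCoeff f (k + 1)) ∧ ∀ x : ℝ,
      HasSum (fun k : ℕ => sinCoeff f (k + 1) * Real.sin ((k + 1) * x)) (f x) := by
  obtain ⟨-, h1, h2⟩ := hasSum_fourier_of_hasDerivAt
    (fun x => (hf.differentiable x).hasDerivAt) (hf.deriv.continuous (by exact_mod_cast hα0))
    hf.periodic hf.deriv.periodic
  refine ⟨(summable_nat_add_iff 1).2 h1, fun x => ?_⟩
  have h := hasSum_nat_succ (h2 x)
  simpa [cosCoeff_eq_zero_of_odd ho] using h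

/-- Evenness kills the sine terms and mean zero the constant, so the absolutely convergent Fourier
series has the form that defines X. -/
theorem exists_mem_spaceX {A : ℝ} {f : ℝ → ℝ} (hα0 : 0 < α)
    (hf : HolderBound α 3 A f) (he : Function.Even f) (h0 : cosCoeff f 0 = 0) :
    ∃ x : spaceX α, (x : HolderTorus 3 α).toFun = f ∧ ‖x‖ ≤ 5 * A := by
  obtain ⟨h1, h2⟩ := hf.hasSum_cos hα0 he h0
  refine ⟨⟨hf.toHolderTorus hα0, _, h1, h2⟩, rfl, ?_⟩
  have h3 : HolderBound α 3 A (hf.toHolderTorus hα0) := hf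
  refine h3.norm_le.trans (le_of_eq ?_)
  norm_num

theorem exists_mem_spaceY {A : ℝ} {f : ℝ → ℝ} (hα0 : 0 < α)
    (hf : HolderBound α 1 A f) (ho : Function.Odd f) :
    ∃ y : spaceY α, (y : HolderTorus 1 α).toFun = f ∧ ‖y‖ ≤ 3 * A := by
  obtain ⟨h1, h2⟩ := hf.hasSum_sin hα0 ho
  refine ⟨⟨hf.toHolderTorus hα0, _, h1, h2⟩, rfl, ?_⟩
  have h3 : HolderBound α 1 A (hf.toHolderTorus hα0) := hf
  refine h3.norm_le.trans (le_of_eq ?_)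
  norm_num

/-- The cosine coefficients, as a linear map on `spaceX`. -/
noncomputable def cosCoeffₗ (α : ℝ≥0) : spaceX α →ₗ[ℝ] (ℕ → ℝ) where
  toFun x k := cosCoeff (x : HolderTorus 3 α) (k + 1)
  map_add' x y := funext fun _ =>
    cosCoeff_add (x : HolderTorus 3 α).contDiff.continuous (y : HolderTorus 3 α).contDiff.continuous _
  map_smul' c _ := funext fun _ => cosCoeff_const_mul c _ _

/-- The sine coefficients, as a linear map on `spaceY`. -/
noncomputable def sinCoeffₗ (α : ℝ≥0) : spaceY α →ₗ[ℝ] (ℕ → ℝ) where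
  toFun x k := sinCoeff (x : HolderTorus 1 α) (k + 1)
  map_add' x y := funext fun _ =>
    sinCoeff_add (x : HolderTorus 1 α).contDiff.continuous (y : HolderTorus 1 α).contDiff.continuous _
  map_smul' c _ := funext fun _ => sinCoeff_const_mul c _ _

theorem cosCoeffₗ_injective : Function.Injective (cosCoeffₗ α) := by
  rintro ⟨f, a, ha, hf⟩ ⟨g, b, hb, hg⟩ h
  have e : a = b := funext fun k => by
    rw [← cosCoeff_succ_of_hasSum ha hf k, ← cosCoeff_succ_of_hasSum hb hg k]
    exact congrFun h k
  subst e
  exact Subtype.ext (HolderTorus.toFun_injective (funext fun x => (hf x).unique (hg x)))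

theorem sinCoeffₗ_injective : Function.Injective (sinCoeffₗ α) := by
  rintro ⟨f, a, ha, hf⟩ ⟨g, b, hb, hg⟩ h
  have e : a = b := funext fun k => by
    rw [← sinCoeff_succ_of_hasSum ha hf k, ← sinCoeff_succ_of_hasSum hb hg k]
    exact congrFun h k
  subst e
  exact Subtype.ext (HolderTorus.toFun_injective (funext fun x => (hf x).unique (hg x)))

end spaces

theorem odd_deriv_of_even {f : ℝ → ℝ} (he : Function.Even f) : Function.Odd (deriv f) := by
  intro x
  have h := deriv_comp_neg f x
  rw [show (fun x => f (-x)) = f from funext he] at h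
  rw [h, neg_neg]

theorem even_deriv_of_odd {f : ℝ → ℝ} (ho : Function.Odd f) : Function.Even (deriv f) := by
  intro x
  have h := deriv_comp_neg f x
  rw [show (fun x => f (-x)) = fun x => -f x from funext ho, deriv.fun_neg] at h
  exact (neg_injective h).symm

/-! ### Linear and quadratic parts of the operator. -/

/-- The linear part of the travelling-wave operator. -/
noncomputable def linPart (P Q R : ℝ) (h : ℝ → ℝ) (ξ : ℝ) : ℝ :=
  P * deriv h ξ + Q * hilbert (iteratedDeriv 2 h) ξ + R * (deriv h ξ + hilbert h ξ)

/-- The quadratic part of the travelling-wave operator. -/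
noncomputable def quadPart (γ : ℝ) (φ : ℝ → ℝ) (ξ : ℝ) : ℝ :=
  hilbert (fun y => (hilbert (deriv φ) y) ^ 2) ξ - hilbertCommutator φ (hilbert (deriv φ)) ξ -
    γ * hilbertCommutator φ (hilbert (iteratedDeriv 3 φ)) ξ

theorem waveF_eq (α₀ β ε c : ℝ) (φ : ℝ → ℝ) (ξ : ℝ) :
    waveF α₀ β ε c φ ξ = linPart (2 * c) (c * α₀ + (α₀ - β) / ε) (1 / ε) φ ξ +
      quadPart (α₀ - β) φ ξ := by
  rw [waveF, linPart, quadPart]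
  ring

section

variable {α : ℝ}

/-- H sends cosine to sine coefficients and each derivative multiplies by the frequency up to sign.
The derivatives in the first and third terms merge into the linear coefficient P + R. -/
theorem exists_linPart_bound (hα0 : 0 < α) (hα1 : α < 1) (P Q R : ℝ) :
    ∃ C, 0 ≤ C ∧ ∀ (A : ℝ) (h : ℝ → ℝ), HolderBound α 3 A h → Function.Even h →
      HolderBound α 1 (C * A) (linPart P Q R h) ∧ Function.Odd (linPart P Q R h) ∧
        ∀ k : ℕ, sinCoeff (linPart P Q R h) (k + 1) =
          -quadSymbol Q (P + R) R k * cosCoeff h (k + 1) := by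
  obtain ⟨C, hC, hH⟩ := exists_holderBound_hilbert hα0 hα1
  refine ⟨|P| * 2 + |Q| * C + |R| * (2 + C * 2), by positivity, fun A h hh he => ?_⟩
  have e2 : iteratedDeriv 2 h = deriv (deriv h) := by
    rw [iteratedDeriv_succ, iteratedDeriv_one]
  have h1 := hh.deriv.of_succ hα0 hα1
  have h2 := hh.deriv.deriv
  have h2' := h2.of_succ hα0 hα1
  have h3 := hh.of_le hα0 hα1 (m := 1) (by lia)
  have h3' := hh.of_le hα0 hα1 (m := 0) (by lia)
  have o1 := odd_deriv_of_even he
  have o2 := h2'.odd_hilbert hα0 hα1 (even_deriv_of_odd o1)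
  have o3 := h3'.odd_hilbert hα0 hα1 he
  have b2 := hH _ _ _ h2
  have b3 := hH _ _ _ h3
  have c1 := h1.continuous hα0
  have c2 := b2.continuous hα0
  have c3 := b3.continuous hα0
  have e : linPart P Q R h = fun ξ =>
      P * deriv h ξ + Q * hilbert (deriv (deriv h)) ξ + R * (deriv h ξ + hilbert h ξ) := by
    funext ξ
    rw [linPart, e2]
  rw [e]
  refine ⟨(((h1.const_mul P).add (b2.const_mul Q)).add ((h1.add b3).const_mul R)).mono
    (le_of_eq (by ring)), fun x => ?_, fun k => ?_⟩
  · beta_reduce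
    rw [o1, o2, o3]
    ring
  · rw [sinCoeff_add (by fun_prop) (by fun_prop), sinCoeff_add (by fun_prop) (by fun_prop),
      sinCoeff_const_mul, sinCoeff_const_mul, sinCoeff_const_mul, sinCoeff_add c1 c3,
      h2'.sinCoeff_hilbert hα0 hα1, h3'.sinCoeff_hilbert hα0 hα1,
      cosCoeff_deriv (fun x => (hh.deriv.differentiable x).hasDerivAt) (h2.continuous hα0)
        hh.deriv.periodic,
      sinCoeff_deriv (fun x => (hh.differentiable x).hasDerivAt) c1 hh.periodic, quadSymbol]
    push_cast
    ring

/-- The first two terms use only Privalov and products; the last needs the smoothing of the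
commutator, with G = Hφ''. H exchanges parities and φ, Hφ', Hφ''' are even, so every term is odd. -/
theorem exists_quadPart_bound (hα0 : 0 < α) (hα1 : α < 1) (γ : ℝ) :
    ∃ C, 0 ≤ C ∧ ∀ (A : ℝ) (φ : ℝ → ℝ), HolderBound α 3 A φ → Function.Even φ →
      HolderBound α 1 (C * A ^ 2) (quadPart γ φ) ∧ Function.Odd (quadPart γ φ) := by
  obtain ⟨C, hC, hH⟩ := exists_holderBound_hilbert hα0 hα1
  refine ⟨C * (8 * (C * 2 * (C * 2))) + (C * (8 * (2 * (C * 2))) + 8 * (2 * (C * (C * 2)))) +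
    |γ| * (180 * C), by positivity, fun A φ hφ he => ?_⟩
  have e3 : iteratedDeriv 3 φ = deriv (deriv (deriv φ)) := by
    rw [iteratedDeriv_succ, iteratedDeriv_succ, iteratedDeriv_one]
  have d1 := hφ.deriv.of_succ hα0 hα1
  have d10 := hφ.deriv.of_le hα0 hα1 (m := 0) (by lia)
  have d2 := hφ.deriv.deriv
  have d20 := d2.of_succ hα0 hα1
  have f1 := hφ.of_le hα0 hα1 (m := 1) (by lia)
  have o1 := odd_deriv_of_even he
  have ev2 := even_deriv_of_odd o1
  set g := hilbert (deriv φ)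
  have bg := hH _ _ _ d1
  have bg0 := bg.of_succ hα0 hα1
  have eg : Function.Even g := d10.even_hilbert hα0 hα1 o1
  have og : Function.Odd (hilbert g) := bg0.odd_hilbert hα0 hα1 eg
  have bsq := bg.mul hα0 hα1 bg
  have bφg := f1.mul hα0 hα1 bg
  have b1 := hH _ _ _ bsq
  have b2 := hH _ _ _ bφg
  have b3 := f1.mul hα0 hα1 (hH _ _ _ bg)
  have bG := hH _ _ _ d2
  have b4 := hφ.hilbertCommutator hα0 hα1 bG
  have eG : deriv (hilbert (deriv (deriv φ))) = hilbert (deriv (deriv (deriv φ))) :=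
    d2.deriv_hilbert hα0 hα1
  rw [eG] at b4
  have hd3 := d2.deriv
  have od3 : Function.Even (hilbert (deriv (deriv (deriv φ)))) :=
    hd3.even_hilbert hα0 hα1 (odd_deriv_of_even ev2)
  have oG : Function.Odd (hilbert (hilbert (deriv (deriv (deriv φ))))) :=
    (hH _ _ _ hd3).odd_hilbert hα0 hα1 od3
  have oφG : Function.Odd (hilbert fun y => φ y * hilbert (deriv (deriv (deriv φ))) y) :=
    ((hφ.of_le hα0 hα1 (Nat.zero_le _)).mul hα0 hα1 (hH _ _ _ hd3)).odd_hilbert hα0 hα1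
      fun x => by simp only [he x, od3 x]
  have oφg : Function.Odd (hilbert fun y => φ y * g y) :=
    (bφg.of_succ hα0 hα1).odd_hilbert hα0 hα1 fun x => by simp only [he x, eg x]
  have osq : Function.Odd (hilbert fun y => g y * g y) :=
    (bsq.of_succ hα0 hα1).odd_hilbert hα0 hα1 fun x => by simp only [eg x]
  have e : quadPart γ φ = fun ξ => hilbert (fun y => g y * g y) ξ -
      (hilbert (fun y => φ y * g y) ξ - φ ξ * hilbert g ξ) -
      γ * hilbertCommutator φ (hilbert (deriv (deriv (deriv φ)))) ξ := by
    funext ξ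
    simp only [quadPart, e3, sq]
    rfl
  rw [e]
  refine ⟨((b1.sub (b2.sub b3)).sub (b4.const_mul γ)).mono (le_of_eq (by ring)), fun x => ?_⟩
  simp only [hilbertCommutator]
  rw [osq, oφg, og, oφG, oG, he]
  ring

end

section spaces

variable {α : ℝ≥0}

theorem exists_sinCoeffₗ_eq_single (hα0 : 0 < α) (hα1 : α < 1) (k : ℕ) :
    ∃ (A : ℝ) (f : ℝ → ℝ), HolderBound α 1 A f ∧ Function.Odd f ∧
      ∀ j, sinCoeff f (j + 1) = (Pi.single k 1 : ℕ → ℝ) j := by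
  obtain ⟨C, -, hC⟩ := exists_holderBound_sine_series (α := α) (by exact_mod_cast hα0)
    (by exact_mod_cast hα1)
  obtain ⟨f, hf, ho, hk⟩ := hC ((k + 1 : ℝ) ^ 4) (Pi.single k 1) fun j => by
    rcases eq_or_ne j k with rfl | h
    · rw [Pi.single_eq_same, abs_one, div_self (by positivity)]
    · rw [Pi.single_eq_of_ne h, abs_zero]
      positivity
  exact ⟨_, f, hf, ho, hk⟩

end spaces

theorem proposition3p2 (α : ℝ≥0) (hα0 : 0 < α) (hα1 : α < 1)
    (α₀ β ε c : ℝ) (hα₀ : 0 < α₀) (hε : 0 < ε) (hc : c * α₀ + (α₀ - β) / ε ≠ 0) :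
    ∃ (Fc : spaceX α → spaceY α) (T : spaceX α →L[ℝ] spaceY α),
      (∀ (φ : spaceX α) (ξ : ℝ), (Fc φ : HolderTorus 1 α) ξ = waveF α₀ β ε c (φ : HolderTorus 3 α) ξ) ∧
      HasFDerivAt Fc T 0 ∧
      (∀ (h : spaceX α) (ξ : ℝ), (T h : HolderTorus 1 α) ξ =
        2 * c * deriv (h : HolderTorus 3 α) ξ
          + (c * α₀ + (α₀ - β) / ε) * hilbert (iteratedDeriv 2 (h : HolderTorus 3 α)) ξ
          + (1 / ε) * (deriv (h : HolderTorus 3 α) ξ + hilbert (h : HolderTorus 3 α) ξ)) ∧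
      T.IsFredholm ∧ (T : spaceX α →ₗ[ℝ] spaceY α).index = 0 := by
  have ha0 : (0 : ℝ) < α := by exact_mod_cast hα0
  have ha1 : (α : ℝ) < 1 := by exact_mod_cast hα1
  set P := 2 * c
  set Q := c * α₀ + (α₀ - β) / ε
  set R := 1 / ε
  obtain ⟨CL, hCL, hL⟩ := exists_linPart_bound ha0 ha1 P Q R
  obtain ⟨CN, hCN, hN⟩ := exists_quadPart_bound ha0 ha1 (α₀ - β)
  obtain ⟨CV, hCV, hV⟩ := exists_parametrix ha0 ha1 hc (P + R) R
  obtain ⟨CS, hCS, hS⟩ := exists_inverse_hilbert_deriv_deriv ha0 ha1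
  have hX : ∀ h : spaceX α, HolderBound α 3 ‖h‖ (h : HolderTorus 3 α) := fun h =>
    (h : HolderTorus 3 α).holderBound
  have hXe : ∀ h : spaceX α, Function.Even (h : HolderTorus 3 α) := fun h => even_of_mem_spaceX h.2
  have hY : ∀ g : spaceY α, HolderBound α 1 ‖g‖ (g : HolderTorus 1 α) := fun g =>
    (g : HolderTorus 1 α).holderBound
  have hYo : ∀ g : spaceY α, Function.Odd (g : HolderTorus 1 α) := fun g => odd_of_mem_spaceY g.2
  obtain ⟨T, hT⟩ := exists_clm_of_coeff (a := cosCoeffₗ α) (b := sinCoeffₗ α) sinCoeffₗ_injective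
    (fun k => -quadSymbol Q (P + R) R k) (3 * CL)
    (fun h g => (g : HolderTorus 1 α).toFun = linPart P Q R (h : HolderTorus 3 α)) fun h => by
      obtain ⟨h1, h2, h3⟩ := hL _ _ (hX h) (hXe h)
      obtain ⟨g, hg, hgn⟩ := exists_mem_spaceY hα0 h1 h2
      refine ⟨g, hg, fun k => ?_, hgn.trans (le_of_eq (by ring))⟩
      change sinCoeff (g : HolderTorus 1 α) (k + 1) = _
      rw [hg]
      exact h3 k
  obtain ⟨v, hv⟩ := exists_clm_of_coeff (a := sinCoeffₗ α) (b := cosCoeffₗ α) cosCoeffₗ_injective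
    (fun k => (-quadSymbol Q (P + R) R k)⁻¹) (5 * CV) (fun _ _ => True) fun g => by
      obtain ⟨h, h1, h2, h3, h4⟩ := hV _ _ (hY g) (hYo g)
      obtain ⟨x, hx, hxn⟩ := exists_mem_spaceX hα0 h1 h2 h3
      refine ⟨x, trivial, fun k => ?_, hxn.trans (le_of_eq (by ring))⟩
      change cosCoeff (x : HolderTorus 3 α) (k + 1) = _
      rw [hx, h4, inv_neg]
      rfl
  have hNex : ∀ φ : spaceX α, ∃ g : spaceY α,
      (g : HolderTorus 1 α).toFun = quadPart (α₀ - β) (φ : HolderTorus 3 α) ∧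
        ‖g‖ ≤ 3 * (CN * ‖φ‖ ^ 2) := fun φ => by
    obtain ⟨h1, h2⟩ := hN _ _ (hX φ) (hXe φ)
    exact exists_mem_spaceY hα0 h1 h2
  choose N hN1 hN2 using hNex
  have hfred := isFredholm_of_diagonal (a := cosCoeffₗ α) (b := sinCoeffₗ α) cosCoeffₗ_injective
    sinCoeffₗ_injective (fun k => by
      obtain ⟨A, f, hf, ho, hk⟩ := exists_sinCoeffₗ_eq_single hα0 hα1 k
      -- The factor -(k + 1)² undoes the multiplier of `hS` at the single active frequency, giving
      -- the k-th unit vector in X.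
      obtain ⟨h, h1, h2, h3, h4⟩ := hS _ _ (hf.const_mul (-(k + 1 : ℝ) ^ 2)) fun x => by
        rw [ho x]; ring
      obtain ⟨x, hx, -⟩ := exists_mem_spaceX hα0 h1 h2 h3
      refine ⟨x, funext fun j => ?_⟩
      change cosCoeff (x : HolderTorus 3 α) (j + 1) = _
      rw [hx, h4, sinCoeff_const_mul, hk]
      rcases eq_or_ne j k with rfl | hjk
      · rw [Pi.single_eq_same]
        field_simp
      · rw [Pi.single_eq_of_ne hjk]
        simp)
    (fun k => by
      obtain ⟨A, f, hf, ho, hk⟩ := exists_sinCoeffₗ_eq_single hα0 hα1 k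
      obtain ⟨g, hg, -⟩ := exists_mem_spaceY hα0 hf ho
      refine ⟨g, funext fun j => ?_⟩
      change sinCoeff (g : HolderTorus 1 α) (j + 1) = _
      rw [hg, hk])
    (by simpa only [neg_eq_zero] using finite_quadSymbol_zeros hc (P + R) R) T v
    (fun x k => (hT x).2 k) fun y k => (hv y).2 k
  refine ⟨fun φ => T φ + N φ, T, fun φ ξ => ?_, ?_, fun h ξ => ?_, hfred.1, hfred.2⟩
  · rw [waveF_eq]
    change (T φ : HolderTorus 1 α) ξ + (N φ : HolderTorus 1 α) ξ = _
    rw [(hT φ).1, hN1]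
  -- The quadratic bound gives both N 0 = 0 and a zero derivative there, so T is the derivative of
  -- the sum.
  · have hN0 : N 0 = 0 := by
      have := hN2 0
      rw [norm_zero] at this
      exact norm_le_zero_iff.1 (by simpa using this)
    have h1 : HasFDerivAt N (0 : spaceX α →L[ℝ] spaceY α) 0 := by
      rw [hasFDerivAt_iff_isLittleO_nhds_zero]
      simp only [zero_add, hN0, sub_zero, zero_apply]
      have h2 : N =O[𝓝 0] fun φ => ‖φ‖ ^ 2 := Asymptotics.IsBigO.of_bound (3 * CN)
        (Eventually.of_forall fun φ => by
          rw [Real.norm_of_nonneg (by positivity)]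
          exact (hN2 φ).trans (le_of_eq (by ring)))
      exact h2.trans_isLittleO (Asymptotics.isLittleO_norm_pow_id one_lt_two)
    have h2 := (T.hasFDerivAt (x := (0 : spaceX α))).add h1
    rw [add_zero] at h2
    exact h2
  · rw [(hT h).1]
    rfl
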